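/- Let $1\le\beta<2$, $0<\hat\alpha<\alpha$, and let $\lambda>0$ satisfy $\kappa\lambda<1$, where $$\kappa=\sup_{J>0}\frac{J^3\sinh(\pi/2)}{\sinh(\pi J/2)}=1.60036\ldots$$ (in particular every $0<\lambda<1/1.601$ is allowed). There are $\rho^*,r^*>0$ and $K>0$, depending only on $\lambda,\alpha,\hat\alpha,\beta$, such that the following holds for all $0<\rho\le\rho^*$, $0<r\le r^*$ with $\rho,r<1$, all $I_+^*>0$, and every function $$g(\varphi,t)=\sum_{k,l\ge 0}a_{k,l}\cos(k\varphi-lt-\sigma_{k,l}),\qquad \hat\alpha\rho^{\beta k}r^{\beta l}\le|a_{k,l}|\le\alpha\rho^kr^l,$$ normalized by $\sigma_{1,0}=\sigma_{0,1}=0$ and $a_{1,0},a_{0,1}>0$, with $|a_{1,0}/a_{0,1}|=\lambda$. Let $p_0(t)=2/\cosh t$, $q_0(t)=4\arctan e^{\pm t}$ be the separatrix of the pendulum $\pm(p^2/2+\cos q-1)$, let $h=\cos q\; g(\varphi,t)$, and let $$\mathcal L(I,\varphi,s)=-\int_{-\infty}^{\infty}\bigl(\cos q_0(x)-\cos 0\bigr)\,g(\varphi+Ix,s+x)\,dx$$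 be its Melnikov potential. Put $A_{k,l}(I)=\dfrac{2\pi(kI-l)}{\sinh(\pi(kI-l)/2)}a_{k,l}$ (equal to $4a_{k,l}$ if $kI=l$); $A_{0,0}$ and $A_{0,1}$ do not depend on $I$. The crest of $\mathcal L(I,\cdot,\cdot)$ is the set $I\,\partial_\varphi\mathcal L+\partial_s\mathcal L=0$, and $\mathcal C_M(I)$ is its connected component through the maximum of $\mathcal L(I,\cdot,\cdot)$ on the torus. Let $\tau^*(I,\varphi,s)$ be the $\tau$ of least absolute value with $(\varphi-I\tau,s-\tau)\in\mathcal C_M(I)$, and let $$\mathcal L^*(I,\tilde\theta)=\mathcal L\bigl(I,\tilde\theta-I\tau^*(I,\tilde\theta,0),-\tau^*(I,\tilde\theta,0)\bigr)$$ be the reduced Poincaré function. Then for every $I\in[-1/2,I_+^*]$: (1) $\mathcal C_M(I)$ is a curve $s=\xi_M(I,\varphi)$ (mod $2\pi$), where $\xi_M(I,\varphi)\in(-\pi,\pi]$ and $A_{0,1}\,\bigl|\xi_M(I,\varphi)+\arcsin(\alpha(I)\sin\varphi)\bigr|\le K(\rho+r)^2$ for all $\varphi$, with $\alpha(I)=IA_{1,0}(I)/A_{0,1}$.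 For $|s|\le\pi/2$ and every $\varphi$, $\tau^*(I,\varphi,s)$ exists and is unique, and $\mathcal L^*(I,\varphi-Is)=\mathcal L(I,\varphi-I\tau^*(I,\varphi,s),s-\tau^*(I,\varphi,s))$. (2) The function $\tilde\theta\mapsto\mathcal L^*(I,\tilde\theta)$ is $C^2$ and $2\pi$-periodic. There are $\theta_M<\theta_m<\theta_M+2\pi$ such that $\theta_M$ is a non-degenerate maximum ($\partial_{\tilde\theta}\mathcal L^*=0$, $\partial^2_{\tilde\theta}\mathcal L^*<0$), $\theta_m$ is a non-degenerate minimum ($\partial_{\tilde\theta}\mathcal L^*=0$, $\partial^2_{\tilde\theta}\mathcal L^*>0$), and $\mathcal L^*(I,\cdot)$ is strictly decreasing on $[\theta_M,\theta_m]$ and strictly increasing on $[\theta_m,\theta_M+2\pi]$, with $\partial_{\tilde\theta}\mathcal L^*\ne0$ in the interiors. The maximum is close to $0$ and the minimum is close to $\pi$: for every $\eta>0$ there are $\rho_\eta,r_\eta>0$, depending only on $\eta,I_+^*,\lambda,\alpha,\hat\alpha,\beta$, such that $\theta_M,\theta_m$ can be chosen with $|\theta_M|<\eta$ and $|\theta_m-\pi|<\eta$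 whenever $\rho\le\rho_\eta$ and $r\le r_\eta$. (3) For all $\tilde\theta$, with $\tau^*=\tau^*(I,\tilde\theta,0)$, $$\Bigl|\mathcal L^*(I,\tilde\theta)-\bigl(A_{0,0}\cos\sigma_{0,0}+A_{1,0}(I)\cos(\tilde\theta-I\tau^*)+A_{0,1}\cos\xi_M(I,\tilde\theta-I\tau^*)\bigr)\Bigr|\le K(\rho+r)^2 .$$ -/

import Mathlib

noncomputable section

namespace APrioriUnstable

/-- The Fourier series `g(φ,t) = ∑_{(k,l) ∈ ℕ²} a_{k,l} cos(kφ - lt - σ_{k,l})`. -/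
def g (a σ : ℕ → ℕ → ℝ) (φ t : ℝ) : ℝ :=
  ∑' kl : ℕ × ℕ, a kl.1 kl.2 * Real.cos (kl.1 * φ - kl.2 * t - σ kl.1 kl.2)

/-- The perturbation `h(p,q,I,φ,t) = f(q) g(φ,t)` with `f(q) = cos q`. -/
def h (a σ : ℕ → ℕ → ℝ) (_p q _I φ t : ℝ) : ℝ :=
  Real.cos q * g a σ φ t

/-- The `p`-component of the separatrix of the pendulum `±(p²/2 + cos q - 1)`. -/
def p₀ (t : ℝ) : ℝ := 2 / Real.cosh t

/-- The `q`-component of the separatrix; `e = 1` or `e = -1` is the sign of the pendulum. -/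
def q₀ (e t : ℝ) : ℝ := 4 * Real.arctan (Real.exp (e * t))

/-- The Melnikov potential `𝓛(I,φ,s)` of `h` along the separatrix. -/
def melnikov (a σ : ℕ → ℕ → ℝ) (e I φ s : ℝ) : ℝ :=
  -∫ x : ℝ, (h a σ (p₀ x) (q₀ e x) I (φ + I * x) (s + x) - h a σ 0 0 I (φ + I * x) (s + x))

/-- `A_{k,l}(I) = 2π (kI-l) / sinh(π(kI-l)/2) · a_{k,l}`; for `kI = l` the factor is understood
as its limit `4`. -/
def A (a : ℕ → ℕ → ℝ) (k l : ℕ) (I : ℝ) : ℝ :=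
  (if (k : ℝ) * I - l = 0 then 4
    else 2 * Real.pi * (k * I - l) / Real.sinh (Real.pi / 2 * (k * I - l))) * a k l

/-- `α(I) = I A_{1,0}(I) / A_{0,1}`. -/
def crestSlope (a : ℕ → ℕ → ℝ) (I : ℝ) : ℝ := I * A a 1 0 I / A a 0 1 I

/-- The crest: the points `(φ,s)` where `I ∂_φ 𝓛 + ∂_s 𝓛 = 0`, with both angles lifted to `ℝ`. -/
def crest (a σ : ℕ → ℕ → ℝ) (e I : ℝ) : Set (ℝ × ℝ) :=
  {x | I * deriv (fun φ => melnikov a σ e I φ x.2) x.1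
      + deriv (fun s => melnikov a σ e I x.1 s) x.2 = 0}

/-- The crest `C_M(I)` through the maximum of `𝓛(I,·,·)`, lifted to `ℝ²`: the union of the
connected components of the crest that contain a maximum point of `𝓛(I,·,·)` (these points
form a `2πℤ²`-periodic set). -/
def crestM (a σ : ℕ → ℕ → ℝ) (e I : ℝ) : Set (ℝ × ℝ) :=
  {x | ∃ m : ℝ × ℝ, (∀ y : ℝ × ℝ, melnikov a σ e I y.1 y.2 ≤ melnikov a σ e I m.1 m.2) ∧
      x ∈ connectedComponentIn (crest a σ e I) m}

/-- The function `ξ_M(I,φ)` whose graph is `C_M(I)`, with the value of the angle `s` taken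
in `(-π, π]`. -/
def xiM (a σ : ℕ → ℕ → ℝ) (e I φ : ℝ) : ℝ :=
  Classical.epsilon fun s => s ∈ Set.Ioc (-Real.pi) Real.pi ∧ (φ, s) ∈ crestM a σ e I

/-- `τ` has minimal absolute value among the parameters at which the straight line
`τ ↦ (φ - Iτ, s - τ)` meets `C_M(I)`. -/
def IsTauStar (a σ : ℕ → ℕ → ℝ) (e I φ s τ : ℝ) : Prop :=
  (φ - I * τ, s - τ) ∈ crestM a σ e I ∧
    ∀ τ' : ℝ, (φ - I * τ', s - τ') ∈ crestM a σ e I → |τ| ≤ |τ'|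

/-- The function `τ*(I,φ,s)`. -/
def tauStar (a σ : ℕ → ℕ → ℝ) (e I φ s : ℝ) : ℝ :=
  Classical.epsilon (IsTauStar a σ e I φ s)

/-- The reduced Poincaré function `𝓛*(I,θ) = 𝓛(I, θ - I τ*(I,θ,0), -τ*(I,θ,0))`. -/
def reducedPoincare (a σ : ℕ → ℕ → ℝ) (e I θ : ℝ) : ℝ :=
  melnikov a σ e I (θ - I * tauStar a σ e I θ 0) (0 - tauStar a σ e I θ 0)

/-- The constant `κ = sup_{J > 0} J³ sinh(π/2) / sinh(πJ/2) = 1.60036…`, the supremum of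
`I α(I) / (a_{1,0} / a_{0,1})`. -/
def kappa : ℝ :=
  sSup ((fun J : ℝ => J ^ 3 * Real.sinh (Real.pi / 2) / Real.sinh (Real.pi / 2 * J)) '' Set.Ioi 0)

open Real in
theorem cube_le_sinh (x : ℝ) (hx : 0 < x) : 0.3709 * x ^ 3 ≤ sinh x := by
  have h := sum_le_hasSum (Finset.range 8) (fun i _ => by positivity) (Real.hasSum_sinh x)
  refine le_trans ?_ h
  have ha0 : 0 ≤ x^2/8.906 := by positivity
  have ha : (-2:ℝ) ≤ x^2 / 8.906 - 1 := by linarith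
  have b2 := one_add_mul_le_pow ha 2
  have b3 := one_add_mul_le_pow ha 3
  have b4 := one_add_mul_le_pow ha 4
  have b5 := one_add_mul_le_pow ha 5
  have b6 := one_add_mul_le_pow ha 6
  have b7 := one_add_mul_le_pow ha 7
  obtain ⟨y, hy⟩ : ∃ y, y = x^2 := ⟨_, rfl⟩
  rw [← hy] at ha b2 b3 b4 b5 b6 b7
  have hy0 : 0 < y := by rw [hy]; positivity
  have key : 0 ≤ 1 + (1/6 - 0.3709) * y + y^2/120 + y^3/5040 + y^4/362880 + y^5/39916800
      + y^6/6227020800 + y^7/1307674368000 := by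
    ring_nf at b2 b3 b4 b5 b6 b7 ⊢
    linarith
  have := mul_nonneg hx.le key
  subst hy
  simp only [Finset.sum_range_succ, Finset.sum_range_zero, Nat.factorial]
  norm_num
  norm_num at this
  nlinarith

open Real in
theorem sinh_half_pi_le : sinh (π/2) ≤ 2.3014 := by
  have h1 : exp (π/2) ≤ 4.8105 := by
    have : π / 2 ≤ 1.5707965 := by have := pi_lt_d6; norm_num at this ⊢; linarith
    refine (exp_le_exp.2 this).trans ?_
    have h := Real.exp_bound' (x := 1.5707965/2) (by norm_num) (by norm_num) (n := 12) (by norm_num)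
    have e : exp (1.5707965:ℝ) = exp (1.5707965/2)^2 := by rw [← exp_nat_mul]; norm_num
    rw [e]
    have h3 : exp (1.5707965/2:ℝ) ≤ 2.193284 := by
      refine h.trans ?_
      simp only [Finset.sum_range_succ, Finset.sum_range_zero, Nat.factorial]
      norm_num
    calc _ ≤ (2.193284:ℝ)^2 := by gcongr
      _ ≤ _ := by norm_num
  rw [sinh_eq, exp_neg]
  have : (4.8105:ℝ)⁻¹ ≤ (exp (π/2))⁻¹ := by gcongr
  norm_num at this h1 ⊢
  linarith

open Real in
theorem kappa_fun_le (J : ℝ) (hJ : 0 < J) : J^3 * sinh (π/2) / sinh (π/2*J) ≤ 1.601 := by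
  have hp := pi_gt_d6
  have hx : 0 < π/2*J := by positivity
  have h1 := cube_le_sinh _ hx
  have h2 := sinh_half_pi_le
  rw [div_le_iff₀ (sinh_pos_iff.2 hx)]
  have : (1.5707:ℝ)^3 ≤ (π/2)^3 := by gcongr; norm_num at hp ⊢; linarith
  have h4 : (1.570796:ℝ)^3 ≤ (π/2)^3 := by gcongr; norm_num at hp ⊢; linarith
  have hJ3 : 0 < J^3 := by positivity
  have : (1.570796:ℝ)^3 * J^3 ≤ (π/2*J)^3 := by rw [mul_pow]; gcongr
  have : J^3 * sinh (π/2) ≤ J^3*2.3014 := by gcongr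
  norm_num at *
  linarith

theorem bddAbove_kappa : BddAbove
    ((fun J : ℝ => J ^ 3 * Real.sinh (Real.pi / 2) / Real.sinh (Real.pi / 2 * J)) '' Set.Ioi 0) := by
  refine ⟨1.601, ?_⟩
  rintro _ ⟨J, hJ, rfl⟩
  exact kappa_fun_le J hJ

/-- The supremum in `kappa` is a genuine one, and `lam < 1 / 1.601` implies `lam < 1 / kappa`. -/
theorem kappa_bounds : 1 ≤ kappa ∧ kappa ≤ 1.601 := by
  constructor
  · refine le_csSup bddAbove_kappa ⟨1, by simp, ?_⟩
    have : Real.sinh (Real.pi / 2) ≠ 0 := (Real.sinh_pos_iff.2 (by positivity)).ne'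
    simp [this]
  · refine csSup_le ⟨_, 1, by simp, rfl⟩ ?_
    rintro _ ⟨J, hJ, rfl⟩
    exact kappa_fun_le J hJ

end APrioriUnstable

end

noncomputable section

namespace APrioriUnstable

open Real MeasureTheory Filter Topology

/-! Along the separatrix cos q₀ - 1 = -2/cosh², and the Fourier transform of 2/cosh² at ω is
`sechWeight ω`. Integrating g term by term turns the Melnikov potential 𝓛 into ∑ A_{k,l}(I) cos(kφ -
ls - σ_{k,l}). The harmonics with k+l ≥ 2 add up to O((ρ+r)²), while the lower bounds and the fixed
ratio λ make a_{1,0} and a_{0,1} both at least of order (ρ+r)^β. As β < 2, 𝓛 is a constant plus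
A_{1,0} cos φ + A_{0,1} cos s up to a relative error δ of order (ρ+r)^(2-β).

For this two-cosine model the crest is A_{0,1} sin s = -I A_{1,0} sin φ. The choice of κ gives I²
A_{1,0} ≤ q A_{0,1} with q = κλ < 1, and the same with |I| for I². Hence |sin s| ≤ q on the crest,
and its part with cos s > 0 is a graph s = ξ(φ) through the maximum. There |cos φ| ≤ cos ξ, so |Iξ'|
≤ q and T(ψ) = ψ - Iξ(ψ) is an increasing bijection: every line φ - Is = θ meets the graph once. On
the crest ∂_s 𝓛 = -I ∂_φ 𝓛, so the derivative of 𝓛* at T(ψ) is ∂_φ 𝓛(ψ, ξ(ψ)), which is close to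
-A_{1,0} sin ψ. Thus 𝓛* has the shape of a cosine.

The delicate point is uniformity in I. Since A_{1,0}(I) decays exponentially, errors in ∂_φ 𝓛 must
be small relative to A_{1,0}, not only to A_{0,1}. By `sechWeight_mul_sub_le` every harmonic with k
≥ 1 decays like `sechWeight I` at the price of a factor 5^l, absorbed by replacing ε = ρ + r with
5ε.

The stability of the model is proved for the abstract structure `NearCosine` (`mem_maxCrest_iff`,
`abs_mul_ξ'_le`, `hasDerivAt_reduced`, `exists_critical_points`); `FourierBounds.nearCosine` shows
that 𝓛 fits it. -/

/-! ### The Fourier transform of 1/cosh². -/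

/-- The factor `2πω / sinh(πω/2)`, with its limit `4` at `ω = 0`. -/
def sechWeight (ω : ℝ) : ℝ :=
  if ω = 0 then 4 else 2 * π * ω / sinh (π / 2 * ω)

theorem A_eq (a : ℕ → ℕ → ℝ) (k l : ℕ) (I : ℝ) : A a k l I = sechWeight (k * I - l) * a k l := rfl

/-- The logistic map `t ↦ 1 / (1 + e^{-2t})`, an increasing bijection from `ℝ` onto `(0,1)`. -/
def logistic (t : ℝ) : ℝ := exp t / (2 * cosh t)

theorem one_sub_logistic (t : ℝ) : 1 - logistic t = exp (-t) / (2 * cosh t) := by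
  have := (cosh_pos t).ne'
  rw [logistic, eq_div_iff (by positivity), sub_mul, div_mul_cancel₀ _ (by positivity), cosh_eq]
  ring

theorem hasDerivAt_logistic (t : ℝ) : HasDerivAt logistic (1 / (2 * cosh t ^ 2)) t := by
  have hc := (cosh_pos t).ne'
  have h := (Real.hasDerivAt_exp t).div ((Real.hasDerivAt_cosh t).const_mul 2) (by positivity)
  refine h.congr_deriv ?_
  have e : exp t * (cosh t - sinh t) = 1 := by
    rw [cosh_sub_sinh, ← exp_add]; simp
  field_simp
  linear_combination e

theorem logistic_injective : Function.Injective logistic := by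
  refine (strictMono_of_deriv_pos fun t => ?_).injective
  rw [(hasDerivAt_logistic t).deriv]
  have := cosh_pos t
  positivity

theorem logistic_mem (t : ℝ) : logistic t ∈ Set.Ioo (0 : ℝ) 1 := by
  have := cosh_pos t
  have h1 : 0 < 1 - logistic t := by rw [one_sub_logistic]; positivity
  exact ⟨by rw [logistic]; positivity, by linarith⟩

theorem image_logistic : logistic '' Set.univ = Set.Ioo (0 : ℝ) 1 := by
  ext x
  constructor
  · rintro ⟨t, -, rfl⟩
    exact logistic_mem t
  · rintro ⟨h0, h1⟩
    refine ⟨log (x / (1 - x)) / 2, trivial, ?_⟩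
    set t := log (x / (1 - x)) / 2
    have hx : 0 < 1 - x := by linarith
    have h2 : exp t * exp t = x / (1 - x) := by
      rw [← exp_add, show t + t = log (x / (1 - x)) by ring, exp_log (by positivity)]
    have hp := exp_pos t
    have h3 : x = exp t * exp t * (1 - x) := by rw [h2]; field_simp
    rw [logistic, cosh_eq, exp_neg]
    field_simp
    nlinarith

theorem integrable_inv_cosh_sq : Integrable fun t : ℝ => 1 / (2 * cosh t ^ 2) := by
  have h := (integrableOn_image_iff_integrableOn_abs_deriv_smul MeasurableSet.univ
    (fun x _ => (hasDerivAt_logistic x).hasDerivWithinAt) logistic_injective.injOn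
    (fun _ => (1 : ℝ))).1 (by
      rw [image_logistic]; exact integrableOn_const (by simp) (by simp))
  rw [integrableOn_univ] at h
  refine h.congr (Filter.Eventually.of_forall fun x => ?_)
  have : 0 ≤ 1 / (2 * cosh x ^ 2) := by positivity
  simp only [abs_of_nonneg this, smul_eq_mul, mul_one]

/-- Substitute x = `logistic t`: then dx = dt/(2 cosh² t) and x/(1-x) = e^{2t}, so e^{iωt} =
x^{iω/2} (1-x)^{-iω/2}. -/
theorem integral_inv_cosh_sq_mul_cexp (ω : ℝ) :
    ∫ t : ℝ, ((1 / (2 * cosh t ^ 2) : ℝ) : ℂ) * Complex.exp (ω * t * Complex.I)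
      = Complex.betaIntegral (1 + ω / 2 * Complex.I) (1 - ω / 2 * Complex.I) := by
  rw [Complex.betaIntegral, intervalIntegral.integral_of_le zero_le_one,
    integral_Ioc_eq_integral_Ioo, ← image_logistic,
    integral_image_eq_integral_abs_deriv_smul MeasurableSet.univ
      (fun x _ => (hasDerivAt_logistic x).hasDerivWithinAt) logistic_injective.injOn]
  rw [Measure.restrict_univ]
  congr 1
  ext t
  have hn : 0 ≤ 1 / (2 * cosh t ^ 2) := by positivity
  have hm := logistic_mem t
  have h1 : 0 < 1 - logistic t := by linarith [hm.2]
  rw [abs_of_nonneg hn, Complex.real_smul]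
  congr 1
  have hl : log (logistic t) - log (1 - logistic t) = 2 * t := by
    have := cosh_pos t
    rw [one_sub_logistic, logistic, log_div (exp_pos _).ne' (by positivity),
      log_div (exp_pos _).ne' (by positivity), log_exp, log_exp]
    ring
  have e1 : (1 - (logistic t : ℂ)) = ((1 - logistic t : ℝ) : ℂ) := by push_cast; rfl
  rw [e1, Complex.cpow_def_of_ne_zero (by exact_mod_cast hm.1.ne'),
    Complex.cpow_def_of_ne_zero (by exact_mod_cast h1.ne'), ← Complex.exp_add,
    ← Complex.ofReal_log hm.1.le, ← Complex.ofReal_log h1.le]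
  congr 1
  have hl' : ((log (logistic t) : ℝ) : ℂ) - ((log (1 - logistic t) : ℝ) : ℂ) = 2 * t := by
    exact_mod_cast hl
  linear_combination (-(ω / 2 * Complex.I)) * hl'

/-- With z = iω/2 the integral is Γ(1+z)Γ(1-z)/Γ(2) = zΓ(z)Γ(1-z) = πz/sin(πz), by the reflection
formula. -/
theorem betaIntegral_eq_sechWeight (ω : ℝ) :
    Complex.betaIntegral (1 + ω / 2 * Complex.I) (1 - ω / 2 * Complex.I)
      = ((sechWeight ω / 4 : ℝ) : ℂ) := by
  have h := Complex.Gamma_mul_Gamma_eq_betaIntegral (s := 1 + ω / 2 * Complex.I)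
    (t := 1 - ω / 2 * Complex.I) (by simp) (by simp)
  rw [show (1 + ω / 2 * Complex.I) + (1 - ω / 2 * Complex.I) = (1 : ℂ) + 1 by ring,
    Complex.Gamma_add_one _ one_ne_zero, Complex.Gamma_one, one_mul, one_mul] at h
  rw [← h]
  rcases eq_or_ne ω 0 with rfl | hω
  · simp [sechWeight]
  · have hz : (ω / 2 * Complex.I : ℂ) ≠ 0 := by
      simp [hω]
    rw [add_comm (1 : ℂ), Complex.Gamma_add_one _ hz, mul_assoc, Complex.Gamma_mul_Gamma_one_sub,
      show (π : ℂ) * (ω / 2 * Complex.I) = (π / 2 * ω) * Complex.I by ring, Complex.sin_mul_I,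
      sechWeight, if_neg hω]
    have hs : Complex.sinh (π / 2 * ω) ≠ 0 := by
      have : sinh (π / 2 * ω) ≠ 0 := by
        rw [Ne, sinh_eq_zero]; positivity
      exact_mod_cast this
    push_cast
    field_simp
    norm_num

theorem integral_sech_sq_mul_cos (ω c : ℝ) :
    ∫ t : ℝ, 2 / cosh t ^ 2 * cos (ω * t + c) = sechWeight ω * cos c := by
  have h := integral_inv_cosh_sq_mul_cexp ω
  rw [betaIntegral_eq_sechWeight] at h
  have hi : Integrable fun t : ℝ =>
      ((1 / (2 * cosh t ^ 2) : ℝ) : ℂ) * Complex.exp (ω * t * Complex.I) := by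
    refine (integrable_inv_cosh_sq.ofReal (𝕜 := ℂ)).mul_bdd (c := 1) (by fun_prop) ?_
    refine Filter.Eventually.of_forall fun t => ?_
    rw [show (ω * t * Complex.I : ℂ) = ((ω * t : ℝ) : ℂ) * Complex.I by push_cast; ring,
      Complex.norm_exp_ofReal_mul_I]
  have h2 : ∫ t : ℝ, (Complex.exp (c * Complex.I) * (((1 / (2 * cosh t ^ 2) : ℝ) : ℂ)
      * Complex.exp (ω * t * Complex.I)))
        = Complex.exp (c * Complex.I) * ((sechWeight ω / 4 : ℝ) : ℂ) := by
    rw [integral_const_mul, h]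
  have h3 := congrArg Complex.re h2
  rw [← RCLike.re_eq_complex_re, ← integral_re (hi.const_mul _), RCLike.re_eq_complex_re] at h3
  have e : ∀ t : ℝ, (Complex.exp (c * Complex.I) * (((1 / (2 * cosh t ^ 2) : ℝ) : ℂ)
      * Complex.exp (ω * t * Complex.I))).re = 1 / 4 * (2 / cosh t ^ 2 * cos (ω * t + c)) := by
    intro t
    rw [mul_left_comm, ← Complex.exp_add, Complex.re_ofReal_mul,
      show (c * Complex.I + ω * t * Complex.I : ℂ) = ((ω * t + c : ℝ) : ℂ) * Complex.I by
        push_cast; ring, Complex.exp_ofReal_mul_I_re]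
    have := (cosh_pos t).ne'
    field_simp
    ring
  simp_rw [e] at h3
  rw [integral_const_mul, mul_comm (Complex.exp _), Complex.re_ofReal_mul,
    Complex.exp_ofReal_mul_I_re] at h3
  linarith

theorem integrable_two_div_cosh_sq : Integrable fun t : ℝ => 2 / cosh t ^ 2 := by
  refine (integrable_inv_cosh_sq.const_mul 4).congr (Filter.Eventually.of_forall fun t => ?_)
  have := (cosh_pos t).ne'
  simp only
  field_simp
  norm_num

/-- Along the separatrix, `cos q₀ - 1 = -2 / cosh²`. -/
theorem cos_q₀_sub_one (e : ℝ) (he : e = 1 ∨ e = -1) (t : ℝ) :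
    cos (q₀ e t) - 1 = -(2 / cosh t ^ 2) := by
  have hc := (cosh_pos t).ne'
  have key : ∀ u : ℝ, cos (4 * arctan (exp u)) - 1 = -(2 / cosh u ^ 2) := by
    intro u
    have h1 := cos_sq_arctan (exp u)
    rw [show 4 * arctan (exp u) = 2 * (2 * arctan (exp u)) by ring, cos_two_mul, cos_two_mul, h1,
      cosh_eq, exp_neg]
    have := exp_pos u
    field_simp
    ring
  rcases he with rfl | rfl
  · simpa [q₀] using key t
  · simpa [q₀] using key (-t)

/-! ### Trigonometric series in two angles, and the Melnikov potential as one of them. -/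

/-- The trigonometric series `∑ c_{k,l} cos(kφ - ls - σ_{k,l})`. -/
def trigSeries (c σ : ℕ × ℕ → ℝ) (x : ℝ × ℝ) : ℝ :=
  ∑' n : ℕ × ℕ, c n * cos (n.1 * x.1 - n.2 * x.2 - σ n)

theorem norm_mul_cos_le (c y : ℝ) : ‖c * cos y‖ ≤ |c| := by
  rw [norm_mul, Real.norm_eq_abs, Real.norm_eq_abs]
  exact mul_le_of_le_one_right (abs_nonneg _) (abs_cos_le_one _)

section

variable {c σ : ℕ × ℕ → ℝ}

theorem summable_trigSeries (hc : Summable fun n => |c n|) (x : ℝ × ℝ) :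
    Summable fun n : ℕ × ℕ => c n * cos (n.1 * x.1 - n.2 * x.2 - σ n) :=
  Summable.of_norm_bounded hc fun _ => norm_mul_cos_le _ _

theorem continuous_trigSeries (hc : Summable fun n => |c n|) : Continuous (trigSeries c σ) :=
  continuous_tsum (fun n => by fun_prop) hc fun _ _ => norm_mul_cos_le _ _

theorem abs_trigSeries_le (hc : Summable fun n => |c n|) (x : ℝ × ℝ) :
    |trigSeries c σ x| ≤ ∑' n, |c n| :=
  tsum_of_norm_bounded hc.hasSum fun _ => norm_mul_cos_le _ _

theorem trigSeries_add_fst (φ s : ℝ) :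
    trigSeries c σ (φ + 2 * π, s) = trigSeries c σ (φ, s) := by
  refine tsum_congr fun n => ?_
  rw [show (n.1 : ℝ) * (φ + 2 * π, s).1 - n.2 * (φ + 2 * π, s).2 - σ n
    = ((n.1 : ℝ) * (φ, s).1 - n.2 * (φ, s).2 - σ n) + n.1 * (2 * π) by dsimp only; ring,
    cos_add_nat_mul_two_pi]

theorem trigSeries_add_snd (φ s : ℝ) :
    trigSeries c σ (φ, s + 2 * π) = trigSeries c σ (φ, s) := by
  refine tsum_congr fun n => ?_
  rw [show (n.1 : ℝ) * (φ, s + 2 * π).1 - n.2 * (φ, s + 2 * π).2 - σ n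
    = ((n.1 : ℝ) * (φ, s).1 - n.2 * (φ, s).2 - σ n) - n.2 * (2 * π) by dsimp only; ring,
    cos_sub_nat_mul_two_pi]

/-- Writing -sin as a cosine with phase shifted by π/2 keeps the partial derivatives in the same
class of series, so one tail estimate serves 𝓛 and all its derivatives. -/
theorem hasFDerivAt_trigSeries (hc : Summable fun n : ℕ × ℕ => (1 + n.1 + n.2 : ℝ) * |c n|)
    (x : ℝ × ℝ) :
    HasFDerivAt (trigSeries c σ)
      (trigSeries (fun n => n.1 * c n) (fun n => σ n - π / 2) x • ContinuousLinearMap.fst ℝ ℝ ℝ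
        + trigSeries (fun n => -n.2 * c n) (fun n => σ n - π / 2) x •
          ContinuousLinearMap.snd ℝ ℝ ℝ) x := by
  have hb : ∀ n : ℕ × ℕ, |c n| ≤ (1 + n.1 + n.2 : ℝ) * |c n| := fun n =>
    le_mul_of_one_le_left (abs_nonneg _) (by
      have : (0 : ℝ) ≤ n.1 := by positivity
      have : (0 : ℝ) ≤ n.2 := by positivity
      linarith)
  have hc0 : Summable fun n => |c n| := Summable.of_nonneg_of_le (fun _ => abs_nonneg _) hb hc
  have h1 : Summable fun n : ℕ × ℕ => |(n.1 : ℝ) * c n| := by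
    refine Summable.of_nonneg_of_le (fun _ => abs_nonneg _) (fun n => ?_) hc
    rw [abs_mul, Nat.abs_cast]
    gcongr
    linarith [(Nat.cast_nonneg n.2 : (0 : ℝ) ≤ n.2)]
  have h2 : Summable fun n : ℕ × ℕ => |-(n.2 : ℝ) * c n| := by
    refine Summable.of_nonneg_of_le (fun _ => abs_nonneg _) (fun n => ?_) hc
    rw [abs_mul, abs_neg, Nat.abs_cast]
    gcongr
    linarith [(Nat.cast_nonneg n.1 : (0 : ℝ) ≤ n.1)]
  let f' : ℕ × ℕ → ℝ × ℝ → (ℝ × ℝ →L[ℝ] ℝ) := fun n x =>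
    (n.1 * c n * cos (n.1 * x.1 - n.2 * x.2 - (σ n - π / 2))) • ContinuousLinearMap.fst ℝ ℝ ℝ
      + (-n.2 * c n * cos (n.1 * x.1 - n.2 * x.2 - (σ n - π / 2))) • ContinuousLinearMap.snd ℝ ℝ ℝ
  have hf' : ∀ n x, HasFDerivAt
      (fun x : ℝ × ℝ => c n * cos (n.1 * x.1 - n.2 * x.2 - σ n)) (f' n x) x := by
    intro n x
    have h : HasFDerivAt (fun x : ℝ × ℝ => (n.1 : ℝ) * x.1 - n.2 * x.2 - σ n)
        ((n.1 : ℝ) • ContinuousLinearMap.fst ℝ ℝ ℝ - (n.2 : ℝ) • ContinuousLinearMap.snd ℝ ℝ ℝ) x :=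
      ((hasFDerivAt_fst.const_mul (n.1 : ℝ)).sub (hasFDerivAt_snd.const_mul (n.2 : ℝ))).sub_const _
    refine (h.cos.const_mul (c n)).congr_fderiv ?_
    have e : cos (n.1 * x.1 - n.2 * x.2 - (σ n - π / 2)) = -sin (n.1 * x.1 - n.2 * x.2 - σ n) := by
      rw [← cos_add_pi_div_two]; ring_nf
    ext <;> simp [f', e] <;> ring
  have hn : ∀ n x, ‖f' n x‖ ≤ |(n.1 : ℝ) * c n| + |-(n.2 : ℝ) * c n| := by
    intro n x
    refine (norm_add_le _ _).trans (add_le_add ?_ ?_)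
    · rw [norm_smul]
      exact (mul_le_of_le_one_right (norm_nonneg _) (ContinuousLinearMap.norm_fst_le ..)).trans
        (norm_mul_cos_le _ _)
    · rw [norm_smul]
      exact (mul_le_of_le_one_right (norm_nonneg _) (ContinuousLinearMap.norm_snd_le ..)).trans
        (norm_mul_cos_le _ _)
  refine (hasFDerivAt_tsum (h1.add h2) hf' hn (summable_trigSeries hc0 0) x).congr_fderiv ?_
  have s1 := summable_trigSeries (σ := fun n => σ n - π / 2) h1 x
  have s2 := summable_trigSeries (σ := fun n => σ n - π / 2) h2 x
  exact ((s1.hasSum.smul_const _).add (s2.hasSum.smul_const _)).tsum_eq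

end

theorem summable_pow_mul_half_pow (m : ℕ) :
    Summable fun n : ℕ × ℕ => (1 + n.1 + n.2 : ℝ) ^ m * (1 / 2) ^ (n.1 + n.2) := by
  have h : Summable fun n : ℕ => (1 + n : ℝ) ^ m * (1 / 2) ^ n := by
    have h0 := (summable_nat_add_iff 1).2
      (summable_pow_mul_geometric_of_norm_lt_one (R := ℝ) m (r := 1 / 2) (by norm_num))
    refine (h0.mul_left 2).congr fun n => ?_
    push_cast
    ring
  refine Summable.of_nonneg_of_le (fun n => by positivity) (fun n => ?_)
    (h.mul_of_nonneg h (fun n => by positivity) fun n => by positivity)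
  rw [pow_add, mul_mul_mul_comm, ← mul_pow]
  have h1 : (0 : ℝ) ≤ n.1 := by positivity
  have h2 : (0 : ℝ) ≤ n.2 := by positivity
  gcongr
  nlinarith

/-- The constant in the bounds of the tails of trigonometric series. -/
def tailConst : ℝ := 4 * ∑' n : ℕ × ℕ, (1 + n.1 + n.2 : ℝ) ^ 2 * (1 / 2) ^ (n.1 + n.2)

theorem tailConst_pos : 0 < tailConst := by
  have := (summable_pow_mul_half_pow 2).tsum_pos (fun n => by positivity) (0, 0) (by simp)
  unfold tailConst
  positivity

/-- The part of a family of coefficients with `k + l ≥ 2`. -/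
def tail (c : ℕ × ℕ → ℝ) (n : ℕ × ℕ) : ℝ := if 2 ≤ n.1 + n.2 then c n else 0

theorem trigSeries_eq_add_tail {c σ : ℕ × ℕ → ℝ} (hc : Summable fun n => |c n|) (x : ℝ × ℝ) :
    trigSeries c σ x = c (0, 0) * cos (σ (0, 0)) + c (1, 0) * cos (x.1 - σ (1, 0))
      + c (0, 1) * cos (x.2 + σ (0, 1)) + trigSeries (tail c) σ x := by
  have hs := summable_trigSeries (σ := σ) hc x
  have ht : Summable fun n => |tail c n| := by
    refine Summable.of_nonneg_of_le (fun _ => abs_nonneg _) (fun n => ?_) hc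
    unfold tail
    split_ifs <;> simp
  have hst := summable_trigSeries (σ := σ) ht x
  rw [trigSeries, trigSeries, ← sub_eq_iff_eq_add, ← hs.tsum_sub hst]
  rw [tsum_eq_sum (s := {(0, 0), (1, 0), (0, 1)})]
  · rw [Finset.sum_insert (by simp), Finset.sum_insert (by simp), Finset.sum_singleton]
    have e : cos (-x.2 - σ (0, 1)) = cos (x.2 + σ (0, 1)) := by rw [← cos_neg]; ring_nf
    simp [tail, e]
    ring
  · intro n hn
    have : 2 ≤ n.1 + n.2 := by
      obtain ⟨k, l⟩ := n
      simp only [Finset.mem_insert, Finset.mem_singleton, Prod.mk.injEq, not_or] at hn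
      dsimp only
      omega
    simp [tail, this]

/-- For k+l ≥ 2 and y ≤ 1/2, y^(k+l) ≤ y² (1/2)^(k+l-2), whence the 4 in `tailConst`. The weight
(1+k+l)² leaves room for two derivatives. -/
theorem abs_trigSeries_tail_le {c σ : ℕ × ℕ → ℝ} {C y : ℝ} (hC : 0 ≤ C) (hy : 0 ≤ y)
    (hy2 : y ≤ 1 / 2)
    (hc : ∀ n : ℕ × ℕ, 2 ≤ n.1 + n.2 → |c n| ≤ C * ((1 + n.1 + n.2 : ℝ) ^ 2 * y ^ (n.1 + n.2)))
    (x : ℝ × ℝ) : |trigSeries (tail c) σ x| ≤ C * tailConst * y ^ 2 := by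
  have hb : ∀ n : ℕ × ℕ, |tail c n|
      ≤ 4 * C * y ^ 2 * ((1 + n.1 + n.2 : ℝ) ^ 2 * (1 / 2) ^ (n.1 + n.2)) := by
    intro n
    unfold tail
    split_ifs with h
    · refine (hc n h).trans ?_
      obtain ⟨m, hm⟩ := Nat.exists_eq_add_of_le h
      rw [hm, pow_add, pow_add]
      have : y ^ m ≤ (1 / 2) ^ m := by gcongr
      have h0 : 0 ≤ C * (1 + n.1 + n.2 : ℝ) ^ 2 * y ^ 2 := by positivity
      have := mul_le_mul_of_nonneg_left this h0
      linarith
    · rw [abs_zero]; positivity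
  have hs := (summable_pow_mul_half_pow 2).mul_left (4 * C * y ^ 2)
  have hst : Summable fun n => |tail c n| := Summable.of_nonneg_of_le (fun _ => abs_nonneg _) hb hs
  refine (abs_trigSeries_le hst x).trans ((hst.tsum_le_tsum hb hs).trans_eq ?_)
  rw [tsum_mul_left, tailConst]
  ring

/-- The Melnikov potential as a Fourier series. -/
theorem melnikov_eq_trigSeries {a σ : ℕ → ℕ → ℝ} {e : ℝ} (he : e = 1 ∨ e = -1)
    (ha : Summable fun n : ℕ × ℕ => |a n.1 n.2|) (I φ s : ℝ) :
    melnikov a σ e I φ s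
      = trigSeries (fun n => A a n.1 n.2 I) (fun n => σ n.1 n.2) (φ, s) := by
  let F : ℕ × ℕ → ℝ → ℝ := fun n x =>
    a n.1 n.2 * (2 / cosh x ^ 2 * cos ((n.1 * I - n.2) * x + (n.1 * φ - n.2 * s - σ n.1 n.2)))
  have hint : ∀ ω c : ℝ, Integrable fun x : ℝ => 2 / cosh x ^ 2 * cos (ω * x + c) := fun ω c =>
    integrable_two_div_cosh_sq.mul_bdd (c := 1) (by fun_prop)
      (Filter.Eventually.of_forall fun x => abs_cos_le_one _)
  have hF : ∀ n, Integrable (F n) := fun n => (hint _ _).const_mul _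
  have hS : Summable fun n => ∫ x, ‖F n x‖ := by
    refine Summable.of_nonneg_of_le (fun n => by positivity) (fun n => ?_)
      (ha.mul_right (∫ x : ℝ, 2 / cosh x ^ 2))
    rw [← integral_const_mul]
    refine integral_mono (hF n).norm (integrable_two_div_cosh_sq.const_mul _) fun x => ?_
    simp only [F]
    rw [norm_mul, Real.norm_eq_abs]
    have : (0 : ℝ) ≤ 2 / cosh x ^ 2 := by positivity
    gcongr
    exact (norm_mul_cos_le _ _).trans (abs_of_nonneg this).le
  have hsum := hasSum_integral_of_summable_integral_norm hF hS
  rw [melnikov, trigSeries, ← integral_neg]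
  have e1 : ∀ x, -(h a σ (p₀ x) (q₀ e x) I (φ + I * x) (s + x) - h a σ 0 0 I (φ + I * x) (s + x))
      = ∑' n, F n x := by
    intro x
    rw [h, h, cos_zero, ← sub_mul, cos_q₀_sub_one e he, ← neg_mul,
      neg_neg, g, ← tsum_mul_left]
    refine tsum_congr fun n => ?_
    simp only [F]
    rw [mul_left_comm]
    ring_nf
  simp_rw [e1]
  rw [← hsum.tsum_eq]
  refine tsum_congr fun n => ?_
  simp only [F]
  rw [integral_const_mul, integral_sech_sq_mul_cos, A_eq]
  ring

/-! ### Size of the weights and the role of κ. -/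

theorem sechWeight_of_ne_zero {ω : ℝ} (hω : ω ≠ 0) :
    sechWeight ω = 4 * (π / 2 * |ω| / sinh (π / 2 * |ω|)) := by
  rw [sechWeight, if_neg hω]
  rcases abs_cases ω with ⟨h, _⟩ | ⟨h, _⟩
  · rw [h]; ring
  · rw [h, show π / 2 * -ω = -(π / 2 * ω) by ring, sinh_neg, neg_div_neg_eq]; ring

/-- This bound and `le_self_div_sinh` trap x/sinh x within a factor 2 of (1+2x)e^{-x}, a form in
which shifts of the frequency are easy to compare. Here it reduces to 1+2x ≤ e^{2x}. -/
theorem self_div_sinh_le {x : ℝ} (hx : 0 < x) : x / sinh x ≤ (1 + 2 * x) * exp (-x) := by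
  rw [div_le_iff₀ (sinh_pos_iff.2 hx), sinh_eq]
  have h1 : exp (-x) * exp x = 1 := by rw [← exp_add]; simp
  have h2 : (1 + 2 * x) * (exp (-x) * exp (-x)) ≤ 1 := by
    rw [← exp_add]
    have h3 := add_one_le_exp (2 * x)
    have h4 : exp (2 * x) * exp (-x + -x) = 1 := by rw [← exp_add]; ring_nf; simp
    nlinarith [exp_pos (-x + -x)]
  linear_combination (1 / 2) * h2 - (1 / 2) * (1 + 2 * x) * h1

theorem le_self_div_sinh {x : ℝ} (hx : 0 < x) : (1 + 2 * x) * exp (-x) / 2 ≤ x / sinh x := by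
  rw [le_div_iff₀ (sinh_pos_iff.2 hx), sinh_eq]
  have h1 : exp (-x) * exp x = 1 := by rw [← exp_add]; simp
  have h2 : 1 - 2 * x ≤ exp (-x) * exp (-x) := by
    rw [← exp_add]
    linarith [add_one_le_exp (-x + -x)]
  have h3 : 0 ≤ x * (exp (-x) * exp (-x)) := by positivity
  linear_combination (1 / 4) * h2 + (1 / 2) * h3 + (1 / 4) * (1 + 2 * x) * h1

theorem sechWeight_le (ω : ℝ) :
    sechWeight ω ≤ 4 * ((1 + 2 * (π / 2 * |ω|)) * exp (-(π / 2 * |ω|))) := by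
  rcases eq_or_ne ω 0 with rfl | hω
  · simp [sechWeight]
  · rw [sechWeight_of_ne_zero hω]
    have := self_div_sinh_le (x := π / 2 * |ω|) (by positivity)
    linarith

theorem le_sechWeight (ω : ℝ) :
    2 * ((1 + 2 * (π / 2 * |ω|)) * exp (-(π / 2 * |ω|))) ≤ sechWeight ω := by
  rcases eq_or_ne ω 0 with rfl | hω
  · simp [sechWeight]; norm_num
  · rw [sechWeight_of_ne_zero hω]
    have := le_self_div_sinh (x := π / 2 * |ω|) (by positivity)
    linarith

theorem sechWeight_pos (ω : ℝ) : 0 < sechWeight ω :=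
  lt_of_lt_of_le (by positivity) (le_sechWeight ω)

theorem sechWeight_le_four (ω : ℝ) : sechWeight ω ≤ 4 := by
  rcases eq_or_ne ω 0 with rfl | hω
  · simp [sechWeight]
  · rw [sechWeight_of_ne_zero hω]
    have hx : 0 < π / 2 * |ω| := by positivity
    have : π / 2 * |ω| / sinh (π / 2 * |ω|) ≤ 1 :=
      (div_le_one (sinh_pos_iff.2 hx)).2 (self_le_sinh_iff.2 hx.le)
    linarith

theorem one_add_abs_sq_mul_sechWeight_le (ω : ℝ) : (1 + |ω|) ^ 2 * sechWeight ω ≤ 216 := by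
  set x := π / 2 * |ω| with hx
  have hx0 : 0 ≤ x := by positivity
  have hωx : |ω| ≤ x := by
    have := pi_gt_three
    nlinarith [abs_nonneg ω]
  have h := sechWeight_le ω
  rw [← hx] at h
  have h1 : (1 + x) ^ 3 ≤ 27 * exp x := by
    have h2 : 1 + x ≤ 3 * exp (x / 3) := by linarith [add_one_le_exp (x / 3)]
    calc (1 + x) ^ 3 ≤ (3 * exp (x / 3)) ^ 3 := by gcongr
      _ = 27 * exp x := by rw [mul_pow, ← exp_nat_mul]; norm_num; ring_nf
  have h3 : exp x * exp (-x) = 1 := by rw [← exp_add]; simp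
  calc (1 + |ω|) ^ 2 * sechWeight ω
      ≤ (1 + x) ^ 2 * (4 * ((2 * (1 + x)) * exp (-x))) := by
        gcongr
        · exact (sechWeight_pos ω).le
        · refine h.trans ?_
          gcongr
          linarith
    _ = 8 * ((1 + x) ^ 3 * exp (-x)) := by ring
    _ ≤ 8 * (27 * exp x * exp (-x)) := by gcongr
    _ = 216 := by rw [mul_assoc, h3]; norm_num

theorem exp_half_pi_le : exp (π / 2) ≤ 5 := by
  have h := sinh_half_pi_le
  rw [sinh_eq] at h
  have hp := pi_gt_three
  have h1 : exp (-(π / 2)) ≤ 0.39 := by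
    rw [exp_neg]
    have h2 : (2.57 : ℝ) ≤ exp (π / 2) := by
      have := add_one_le_exp (π / 2)
      have := pi_gt_d2
      norm_num at *
      linarith
    calc (exp (π / 2))⁻¹ ≤ (2.57 : ℝ)⁻¹ := by gcongr
      _ ≤ 0.39 := by norm_num
  norm_num at *
  linarith

/-- Harmonics with `k ≥ 1` decay in `I` at least as fast as the harmonic `(1,0)`. -/
theorem sechWeight_mul_sub_le (k l : ℕ) (hk : 1 ≤ k) (I : ℝ) :
    sechWeight (k * I - l) ≤ 4 * 5 ^ l * sechWeight I := by
  set x := π / 2 * |I| with hx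
  set y := π / 2 * |k * I - l| with hy
  have hp := pi_pos
  have hx0 : 0 ≤ x := by positivity
  have hy0 : 0 ≤ y := by positivity
  -- As k ≥ 1, |I| ≤ |kI - l| + l; the shift by l costs e^{lπ/2} ≤ 5^l.
  have hxy : x ≤ y + l * (π / 2) := by
    have hk' : (1 : ℝ) ≤ k := by exact_mod_cast hk
    have h1 : |I| ≤ |k * I - l| + l := by
      calc |I| ≤ k * |I| := le_mul_of_one_le_left (abs_nonneg _) hk'
        _ = |(k * I - l) + l| := by rw [sub_add_cancel, abs_mul, Nat.abs_cast]
        _ ≤ |k * I - l| + |(l : ℝ)| := abs_add_le _ _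
        _ = _ := by rw [Nat.abs_cast]
    have := mul_le_mul_of_nonneg_left h1 (by positivity : 0 ≤ π / 2)
    linarith
  have h5 : exp (l * (π / 2)) ≤ 5 ^ l := by
    rw [exp_nat_mul]
    gcongr
    exact exp_half_pi_le
  have h51 : (1 : ℝ) ≤ 5 ^ l := one_le_pow₀ (by norm_num)
  have key : (1 + 2 * y) * exp (-y) ≤ 2 * 5 ^ l * ((1 + 2 * x) * exp (-x)) := by
    rcases le_total x y with h | h
    · have h1 : (1 + 2 * y) ≤ (1 + 2 * x) * (2 * exp (y - x)) := by
        have := add_one_le_exp (y - x)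
        nlinarith
      have h2 : exp (y - x) * exp (-y) = exp (-x) := by rw [← exp_add]; ring_nf
      calc (1 + 2 * y) * exp (-y) ≤ (1 + 2 * x) * (2 * exp (y - x)) * exp (-y) := by gcongr
        _ = 2 * 1 * ((1 + 2 * x) * exp (-x)) := by rw [← h2]; ring
        _ ≤ _ := by gcongr
    · have h2 : exp (-y) ≤ 5 ^ l * exp (-x) := by
        calc exp (-y) ≤ exp (l * (π / 2) + -x) := exp_le_exp.2 (by linarith)
          _ = exp (l * (π / 2)) * exp (-x) := exp_add _ _
          _ ≤ _ := by gcongr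
      calc (1 + 2 * y) * exp (-y) ≤ (1 + 2 * x) * (5 ^ l * exp (-x)) := by gcongr
        _ = 1 * 5 ^ l * ((1 + 2 * x) * exp (-x)) := by ring
        _ ≤ _ := by gcongr; norm_num
  have h1 := sechWeight_le (k * I - l)
  have h2 := le_sechWeight I
  rw [← hy] at h1
  rw [← hx] at h2
  calc sechWeight (k * I - l) ≤ 4 * (2 * 5 ^ l * ((1 + 2 * x) * exp (-x))) := by linarith
    _ = 4 * 5 ^ l * (2 * ((1 + 2 * x) * exp (-x))) := by ring
    _ ≤ _ := by gcongr

theorem sechWeight_neg_one : sechWeight (-1) = 2 * π / sinh (π / 2) := by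
  rw [sechWeight_of_ne_zero (by norm_num)]
  simp
  ring

theorem sq_mul_sechWeight_le (I : ℝ) : I ^ 2 * sechWeight I ≤ kappa * sechWeight (-1) := by
  have hκ := kappa_bounds.1
  rcases eq_or_ne I 0 with rfl | hI
  · have := sechWeight_pos (-1)
    simp only [ne_eq, OfNat.ofNat_ne_zero, not_false_eq_true, zero_pow, zero_mul]
    positivity
  · have hJ : 0 < |I| := abs_pos.2 hI
    have h : |I| ^ 3 * sinh (π / 2) / sinh (π / 2 * |I|) ≤ kappa :=
      le_csSup bddAbove_kappa ⟨|I|, hJ, rfl⟩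
    have hs : 0 < sinh (π / 2) := sinh_pos_iff.2 (by positivity)
    have hs' : 0 < sinh (π / 2 * |I|) := sinh_pos_iff.2 (by positivity)
    rw [sechWeight_neg_one, sechWeight_of_ne_zero hI, ← sq_abs]
    calc |I| ^ 2 * (4 * (π / 2 * |I| / sinh (π / 2 * |I|)))
        = |I| ^ 3 * sinh (π / 2) / sinh (π / 2 * |I|) * (2 * π / sinh (π / 2)) := by
          field_simp
          ring
      _ ≤ _ := by gcongr

/-- The left side is 4/`sechWeight (-1)`, which settles `abs_mul_sechWeight_le` for |I| ≤ 1, where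
I² does not dominate |I|. The value J = 1 only gives κ ≥ 1; J = 3/2 is near enough to the maximizer.
-/
theorem sinh_half_pi_le_kappa : sinh (π / 2) * 2 / π ≤ kappa := by
  have h : (3 / 2 : ℝ) ^ 3 * sinh (π / 2) / sinh (π / 2 * (3 / 2)) ≤ kappa :=
    le_csSup bddAbove_kappa ⟨3 / 2, by norm_num, rfl⟩
  refine le_trans ?_ h
  have hs : 0 < sinh (π / 2) := sinh_pos_iff.2 (by positivity)
  have hs' : 0 < sinh (π / 2 * (3 / 2)) := sinh_pos_iff.2 (by positivity)
  have hS := sinh_half_pi_le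
  set t := sinh (π / 4) with ht
  have ht0 : 0 < t := sinh_pos_iff.2 (by positivity)
  have hc : 0 < cosh (π / 4) := cosh_pos _
  have hcs : cosh (π / 4) ^ 2 = 1 + t ^ 2 := by rw [cosh_sq]; ring
  have e2 : sinh (π / 2) = 2 * t * cosh (π / 4) := by rw [ht, ← sinh_two_mul]; ring_nf
  have e3 : sinh (π / 2 * (3 / 2)) = 4 * t ^ 3 + 3 * t := by
    rw [ht, ← sinh_three_mul]; ring_nf
  have htb : t ≤ 0.8688 := by
    by_contra! hlt
    have h1 : (2.3014 : ℝ) ^ 2 < (2 * t * cosh (π / 4)) ^ 2 := by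
      rw [mul_pow, mul_pow, hcs]
      have : (0.8688 : ℝ) ^ 2 < t ^ 2 := by gcongr
      norm_num at this ⊢
      nlinarith
    rw [← e2] at h1
    exact absurd hS (not_le.2 (lt_of_pow_lt_pow_left₀ 2 hs.le h1))
  have h3 : sinh (π / 2 * (3 / 2)) ≤ 5.23 := by
    rw [e3]
    have : t ^ 3 ≤ 0.8688 ^ 3 := by gcongr
    norm_num at this htb ⊢
    linarith
  rw [div_le_div_iff₀ pi_pos hs']
  have hp := pi_gt_d2
  have h4 : 2 * sinh (π / 2 * (3 / 2)) ≤ (3 / 2) ^ 3 * π := by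
    norm_num at hp h3 ⊢
    linarith
  have := mul_le_mul_of_nonneg_left h4 hs.le
  linarith

theorem abs_mul_sechWeight_le (I : ℝ) : |I| * sechWeight I ≤ kappa * sechWeight (-1) := by
  rcases le_total 1 |I| with h | h
  · refine le_trans ?_ (sq_mul_sechWeight_le I)
    have := sechWeight_pos I
    rw [← sq_abs]
    gcongr
    nlinarith
  · have h1 := sechWeight_le_four I
    have hs : 0 < sinh (π / 2) := sinh_pos_iff.2 (by positivity)
    calc |I| * sechWeight I ≤ 1 * 4 := by
          gcongr
          exact (sechWeight_pos I).le
      _ = sinh (π / 2) * 2 / π * sechWeight (-1) := by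
          rw [sechWeight_neg_one]
          field_simp
          norm_num
      _ ≤ _ := by
          gcongr
          · exact (sechWeight_pos _).le
          · exact sinh_half_pi_le_kappa

/-! ### Functions close to a sum of two cosines: the crest as a graph. -/

/-- The implicit function theorem for a scalar equation in the plane. -/
theorem exists_hasDerivAt_implicit {f : ℝ × ℝ → ℝ} {f₁ f₂ : ℝ} {u : ℝ × ℝ}
    (hf : HasStrictFDerivAt f
      (f₁ • ContinuousLinearMap.fst ℝ ℝ ℝ + f₂ • ContinuousLinearMap.snd ℝ ℝ ℝ) u)
    (h₂ : f₂ ≠ 0) :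
    ∃ ζ : ℝ → ℝ, HasDerivAt ζ (-(f₁ / f₂)) u.1 ∧ Tendsto ζ (𝓝 u.1) (𝓝 u.2) ∧
      ∀ᶠ x in 𝓝 u.1, f (x, ζ x) = f u := by
  set f' := f₁ • ContinuousLinearMap.fst ℝ ℝ ℝ + f₂ • ContinuousLinearMap.snd ℝ ℝ ℝ with hf'
  have e1 : (f' ∘L ContinuousLinearMap.inr ℝ ℝ ℝ) ∘L (f₂⁻¹ • ContinuousLinearMap.id ℝ ℝ)
      = ContinuousLinearMap.id ℝ ℝ := by
    ext; simp [hf', h₂]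
  have e2 : (f₂⁻¹ • ContinuousLinearMap.id ℝ ℝ) ∘L (f' ∘L ContinuousLinearMap.inr ℝ ℝ ℝ)
      = ContinuousLinearMap.id ℝ ℝ := by
    ext; simp [hf', h₂]
  have hinv : (f' ∘L ContinuousLinearMap.inr ℝ ℝ ℝ).IsInvertible :=
    ⟨ContinuousLinearEquiv.equivOfInverse' _ _ e1 e2, rfl⟩
  refine ⟨hf.implicitFunctionOfProdDomain hinv, ?_,
    hf.tendsto_implicitFunctionOfProdDomain hinv,
    hf.eventually_apply_implicitFunctionOfProdDomain hinv⟩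
  have h := (hf.hasStrictFDerivAt_implicitFunctionOfProdDomain hinv).hasFDerivAt
  rw [ContinuousLinearMap.inverse_eq e1 e2] at h
  refine h.hasDerivAt.congr_deriv ?_
  simp [hf']
  ring

/-- A doubly periodic `C²` function `L` of two angles, with partial derivatives `L₁`, `L₂`,
`L₁₁`, `L₁₂`, which together with `G = I ∂₁L + ∂₂L` is close to `A cos φ + B cos s` in the sense
needed to control the set `G = 0`. -/
structure NearCosine where
  (L L₁ L₂ L₁₁ L₁₂ G G₁ G₂ : ℝ × ℝ → ℝ)
  (I A B q δ : ℝ)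
  A_pos : 0 < A
  B_pos : 0 < B
  q_nonneg : 0 ≤ q
  q_lt_one : q < 1
  δ_nonneg : 0 ≤ δ
  -- The square is needed in `abs_mul_ξ'_le`, where the surplus is (1-q)/2 · cos² ξ and cos² ξ is
  -- only known to be at least (1-q)/2.
  δ_le : δ ≤ (1 - q) ^ 2 / 100
  abs_mul_A_le : |I| * A ≤ q * B
  sq_mul_A_le : I ^ 2 * A ≤ q * B
  hasFDerivAt_L : ∀ x, HasFDerivAt L
    (L₁ x • ContinuousLinearMap.fst ℝ ℝ ℝ + L₂ x • ContinuousLinearMap.snd ℝ ℝ ℝ) x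
  hasFDerivAt_L₁ : ∀ x, HasFDerivAt L₁
    (L₁₁ x • ContinuousLinearMap.fst ℝ ℝ ℝ + L₁₂ x • ContinuousLinearMap.snd ℝ ℝ ℝ) x
  hasFDerivAt_G : ∀ x, HasFDerivAt G
    (G₁ x • ContinuousLinearMap.fst ℝ ℝ ℝ + G₂ x • ContinuousLinearMap.snd ℝ ℝ ℝ) x
  G_eq : ∀ x, G x = I * L₁ x + L₂ x
  continuous_L₁₁ : Continuous L₁₁
  continuous_L₁₂ : Continuous L₁₂
  continuous_G₁ : Continuous G₁
  continuous_G₂ : Continuous G₂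
  L_add_fst : ∀ φ s, L (φ + 2 * π, s) = L (φ, s)
  L_add_snd : ∀ φ s, L (φ, s + 2 * π) = L (φ, s)
  L₁_add_fst : ∀ φ s, L₁ (φ + 2 * π, s) = L₁ (φ, s)
  G_add_fst : ∀ φ s, G (φ + 2 * π, s) = G (φ, s)
  G_add_snd : ∀ φ s, G (φ, s + 2 * π) = G (φ, s)
  G_near : ∀ φ s, |G (φ, s) + (I * A * sin φ + B * sin s)| ≤ δ * B
  -- The factor 1 + |I| makes both G₁ and I·G₁ controlled, the latter because I·ξ' governs
  -- transversality.
  G₁_near : ∀ φ s, (1 + |I|) * |G₁ (φ, s) + I * A * cos φ| ≤ δ * B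
  G₂_near : ∀ φ s, |G₂ (φ, s) + B * cos s| ≤ δ * B
  L_near : ∀ φ s, |L (φ, s) - L (φ, 0) - B * (cos s - 1)| ≤ δ * B
  -- Derivatives in φ are measured against `A`, which may be far smaller than `B` when |I| is large.
  L₁_near : ∀ φ s, |L₁ (φ, s) + A * sin φ| ≤ δ * A
  L₁₁_near : ∀ φ s, |L₁₁ (φ, s) + A * cos φ| ≤ δ * A
  L₁₂_near : ∀ φ s, |L₁₂ (φ, s)| ≤ δ * A

namespace NearCosine

variable (P : NearCosine)

theorem δ_le' : P.δ ≤ (1 - P.q) / 100 := by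
  have := P.δ_le
  nlinarith [P.q_nonneg, P.q_lt_one]

theorem continuous_L : Continuous P.L :=
  continuous_iff_continuousAt.2 fun x => (P.hasFDerivAt_L x).continuousAt

theorem continuous_G : Continuous P.G :=
  continuous_iff_continuousAt.2 fun x => (P.hasFDerivAt_G x).continuousAt

theorem abs_mul_sin_le (φ : ℝ) : |P.I * P.A * sin φ| ≤ P.q * P.B := by
  have h := P.abs_mul_A_le
  rw [abs_mul, abs_mul, abs_of_pos P.A_pos]
  exact (mul_le_of_le_one_right (mul_nonneg (abs_nonneg _) P.A_pos.le) (abs_sin_le_one _)).trans h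

/-- The zero set of G avoids cos s = 0, so it splits into a part with cos s > 0 and a part with cos
s < 0. The midpoint (1+q)/2 replaces the model's q to absorb δ. -/
theorem abs_sin_le_of_G_eq_zero {φ s : ℝ} (h : P.G (φ, s) = 0) : |sin s| ≤ (1 + P.q) / 2 := by
  have h1 := P.G_near φ s
  have h2 := P.abs_mul_sin_le φ
  have h3 := P.δ_le'
  have hB := P.B_pos
  have hq := P.q_lt_one
  rw [h, zero_add] at h1
  have h4 : P.B * |sin s| ≤ P.B * ((1 + P.q) / 2) := by
    calc P.B * |sin s| = |(P.I * P.A * sin φ + P.B * sin s) - P.I * P.A * sin φ| := by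
          rw [add_sub_cancel_left, abs_mul, abs_of_pos hB]
      _ ≤ P.δ * P.B + P.q * P.B := (abs_sub _ _).trans (add_le_add h1 h2)
      _ ≤ _ := by nlinarith
  exact le_of_mul_le_mul_left h4 hB

theorem cos_sq_ge {s : ℝ} (h : |sin s| ≤ (1 + P.q) / 2) : (1 - P.q) / 2 ≤ cos s ^ 2 := by
  have h1 : sin s ^ 2 ≤ ((1 + P.q) / 2) ^ 2 := by rw [← sq_abs]; gcongr
  have h2 := P.q_nonneg
  have h3 := P.q_lt_one
  nlinarith [sin_sq_add_cos_sq s]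

theorem cos_ge {s : ℝ} (h : |sin s| ≤ (1 + P.q) / 2) (h0 : 0 ≤ cos s) : (1 - P.q) / 2 ≤ cos s := by
  have := P.cos_sq_ge h
  nlinarith [cos_le_one s]

theorem G₂_neg {φ s : ℝ} (h : |sin s| ≤ (1 + P.q) / 2) (h0 : 0 ≤ cos s) : P.G₂ (φ, s) < 0 := by
  have h1 := P.cos_ge h h0
  have h2 := (abs_le.1 (P.G₂_near φ s)).2
  have h3 := P.δ_le'
  have h4 := P.q_lt_one
  have hB := P.B_pos
  have : 0 < P.B * (cos s - P.δ) := mul_pos hB (by linarith)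
  linarith

theorem hasDerivAt_G_snd (φ s : ℝ) : HasDerivAt (fun s => P.G (φ, s)) (P.G₂ (φ, s)) s := by
  have h := (P.hasFDerivAt_G (φ, s)).comp_hasDerivAt s ((hasDerivAt_const s φ).prodMk (hasDerivAt_id s))
  refine h.congr_deriv ?_
  simp

theorem strictAntiOn_G (φ : ℝ) : StrictAntiOn (fun s => P.G (φ, s))
    (Set.Icc (-arcsin ((1 + P.q) / 2)) (arcsin ((1 + P.q) / 2))) := by
  refine strictAntiOn_of_deriv_neg (convex_Icc _ _) ?_ fun s hs => ?_
  · exact (P.continuous_G.comp (by fun_prop)).continuousOn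
  · rw [(P.hasDerivAt_G_snd φ s).deriv]
    have hs' := interior_subset hs
    have hl := arcsin_le_pi_div_two ((1 + P.q) / 2)
    have hq := P.q_nonneg
    have hq' := P.q_lt_one
    refine P.G₂_neg (abs_le.2 ⟨?_, ?_⟩) (cos_nonneg_of_neg_pi_div_two_le_of_le ?_ ?_)
    · have : sin (-arcsin ((1 + P.q) / 2)) ≤ sin s :=
        sin_le_sin_of_le_of_le_pi_div_two (by linarith) (by linarith [hs'.2]) hs'.1
      rwa [sin_neg, sin_arcsin (by linarith) (by linarith)] at this
    · have : sin s ≤ sin (arcsin ((1 + P.q) / 2)) :=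
        sin_le_sin_of_le_of_le_pi_div_two (by linarith [hs'.1]) hl hs'.2
      rwa [sin_arcsin (by linarith) (by linarith)] at this
    · linarith [hs'.1]
    · linarith [hs'.2]

theorem mem_Icc_of_G_eq_zero {φ s : ℝ} (hs : s ∈ Set.Ioo (-(π / 2)) (π / 2))
    (h : P.G (φ, s) = 0) :
    s ∈ Set.Icc (-arcsin ((1 + P.q) / 2)) (arcsin ((1 + P.q) / 2)) := by
  have h1 := abs_le.1 (P.abs_sin_le_of_G_eq_zero h)
  constructor
  · rw [← arcsin_neg]
    exact (arcsin_le_iff_le_sin' ⟨hs.1.le, hs.2⟩).2 h1.1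
  · exact (le_arcsin_iff_sin_le' ⟨hs.1, hs.2.le⟩).2 h1.2

theorem existsUnique_zero (φ : ℝ) :
    ∃! s, s ∈ Set.Ioo (-(π / 2)) (π / 2) ∧ P.G (φ, s) = 0 := by
  have hq := P.q_nonneg
  have hq' := P.q_lt_one
  have hδ := P.δ_le'
  have hB := P.B_pos
  have hse : sin (arcsin ((1 + P.q) / 2)) = (1 + P.q) / 2 :=
    sin_arcsin (by linarith) (by linarith)
  have ha := abs_le.1 (P.abs_mul_sin_le φ)
  set s₁ := arcsin ((1 + P.q) / 2) with hs₁
  have h0 : 0 ≤ s₁ := arcsin_nonneg.2 (by linarith)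
  have hlt : s₁ < π / 2 := arcsin_lt_pi_div_two.2 (by linarith)
  have hpos : 0 < P.B * ((1 + P.q) / 2 - P.q - P.δ) := mul_pos hB (by linarith)
  have h1 : P.G (φ, s₁) ≤ 0 := by
    have := (abs_le.1 (P.G_near φ s₁)).2
    rw [hse] at this
    linarith
  have h2 : 0 ≤ P.G (φ, -s₁) := by
    have := (abs_le.1 (P.G_near φ (-s₁))).1
    rw [sin_neg, hse] at this
    linarith
  have hc : Continuous fun s => P.G (φ, s) := P.continuous_G.comp (by fun_prop)
  obtain ⟨s, hs, hs0⟩ := intermediate_value_Icc' (by linarith) hc.continuousOn ⟨h1, h2⟩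
  refine ⟨s, ⟨⟨by linarith [hs.1], by linarith [hs.2]⟩, hs0⟩, ?_⟩
  rintro t ⟨ht, ht0⟩
  exact (P.strictAntiOn_G φ).injOn (P.mem_Icc_of_G_eq_zero ht ht0) hs (ht0.trans hs0.symm)

/-- The zero `s = ξ(φ)` of `G(φ,·)` in `(-π/2, π/2)`. -/
def ξ (φ : ℝ) : ℝ := (P.existsUnique_zero φ).choose

theorem ξ_mem (φ : ℝ) : P.ξ φ ∈ Set.Ioo (-(π / 2)) (π / 2) :=
  (P.existsUnique_zero φ).choose_spec.1.1

theorem G_ξ (φ : ℝ) : P.G (φ, P.ξ φ) = 0 := (P.existsUnique_zero φ).choose_spec.1.2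

theorem eq_ξ {φ s : ℝ} (hs : s ∈ Set.Ioo (-(π / 2)) (π / 2)) (h : P.G (φ, s) = 0) : s = P.ξ φ :=
  (P.existsUnique_zero φ).choose_spec.2 s ⟨hs, h⟩

theorem abs_ξ_lt (φ : ℝ) : |P.ξ φ| < π / 2 := abs_lt.2 (P.ξ_mem φ)

theorem cos_ξ_pos (φ : ℝ) : 0 < cos (P.ξ φ) := cos_pos_of_mem_Ioo (P.ξ_mem φ)

theorem ξ_periodic : Function.Periodic P.ξ (2 * π) := fun φ =>
  P.eq_ξ (P.ξ_mem _) (by rw [← P.G_add_fst]; exact P.G_ξ _)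

/-- The derivative of `ξ`. -/
def ξ' (φ : ℝ) : ℝ := -(P.G₁ (φ, P.ξ φ) / P.G₂ (φ, P.ξ φ))

theorem G₂_ξ_neg (φ : ℝ) : P.G₂ (φ, P.ξ φ) < 0 :=
  P.G₂_neg (P.abs_sin_le_of_G_eq_zero (P.G_ξ φ)) (P.cos_ξ_pos φ).le

/-- The local implicit function must agree with `ξ`, since it stays in (-π/2, π/2), where the zero
of G(φ,·) is unique. -/
theorem hasDerivAt_ξ (φ : ℝ) : HasDerivAt P.ξ (P.ξ' φ) φ := by
  have hs := hasStrictFDerivAt_of_hasFDerivAt_of_continuousAt (x := (φ, P.ξ φ))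
    (Eventually.of_forall P.hasFDerivAt_G)
    (((P.continuous_G₁.smul continuous_const).add
      (P.continuous_G₂.smul continuous_const)).continuousAt)
  obtain ⟨ζ, h1, h2, h3⟩ := exists_hasDerivAt_implicit hs (P.G₂_ξ_neg φ).ne
  refine h1.congr_of_eventuallyEq ?_
  filter_upwards [h3, h2.eventually (isOpen_Ioo.mem_nhds (P.ξ_mem φ))] with x hx hx'
  exact (P.eq_ξ hx' (hx.trans (P.G_ξ φ))).symm

theorem continuous_ξ : Continuous P.ξ :=
  continuous_iff_continuousAt.2 fun x => (P.hasDerivAt_ξ x).continuousAt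

theorem continuous_ξ' : Continuous P.ξ' :=
  ((P.continuous_G₁.comp (continuous_id.prodMk P.continuous_ξ)).div
    (P.continuous_G₂.comp (continuous_id.prodMk P.continuous_ξ)) fun φ => (P.G₂_ξ_neg φ).ne).neg

theorem abs_sin_ξ_add_le (φ : ℝ) : |P.B * sin (P.ξ φ) + P.I * P.A * sin φ| ≤ P.δ * P.B := by
  have h := P.G_near φ (P.ξ φ)
  rwa [P.G_ξ, zero_add, add_comm] at h

theorem abs_sin_ξ_le (φ : ℝ) : |sin (P.ξ φ)| ≤ |sin φ| + P.δ := by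
  have h := P.abs_sin_ξ_add_le φ
  have ha := P.abs_mul_A_le
  have hB := P.B_pos
  have hq1 := P.q_lt_one
  have h2 : P.B * |sin (P.ξ φ)| ≤ P.B * (|sin φ| + P.δ) := by
    calc P.B * |sin (P.ξ φ)|
        = |(P.B * sin (P.ξ φ) + P.I * P.A * sin φ) - P.I * P.A * sin φ| := by
          rw [add_sub_cancel_right, abs_mul, abs_of_pos hB]
      _ ≤ P.δ * P.B + |P.I| * P.A * |sin φ| := by
          refine (abs_sub _ _).trans (add_le_add h ?_)
          rw [abs_mul, abs_mul, abs_of_pos P.A_pos]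
      _ ≤ P.δ * P.B + 1 * P.B * |sin φ| := by
          have h5 : P.q * P.B ≤ 1 * P.B := by gcongr
          have := mul_le_mul_of_nonneg_right (ha.trans h5) (abs_nonneg (sin φ))
          linarith
      _ = _ := by ring
  exact le_of_mul_le_mul_left h2 hB

/-- On the crest, `|cos φ|` exceeds `cos ξ(φ)` by little. -/
theorem abs_cos_le (φ : ℝ) : cos (P.ξ φ) * |cos φ| ≤ cos (P.ξ φ) ^ 2 + 2 * P.δ := by
  have hδ := P.δ_nonneg
  have hδ1 := P.δ_le'
  have hq := P.q_nonneg
  have hq1 := P.q_lt_one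
  have hc := P.cos_ge (P.abs_sin_le_of_G_eq_zero (P.G_ξ φ)) (P.cos_ξ_pos φ).le
  have h1 := P.abs_sin_ξ_le φ
  have h3 : sin (P.ξ φ) ^ 2 ≤ (|sin φ| + P.δ) ^ 2 := by rw [← sq_abs]; gcongr
  have h4 : cos φ ^ 2 ≤ cos (P.ξ φ) ^ 2 + 3 * P.δ := by
    have := sq_abs (sin φ)
    have := abs_sin_le_one φ
    nlinarith [sin_sq_add_cos_sq φ, sin_sq_add_cos_sq (P.ξ φ), abs_nonneg (sin φ)]
  have hc0 := P.cos_ξ_pos φ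
  refine (abs_le_of_sq_le_sq' (a := cos (P.ξ φ) * |cos φ|) ?_ (by positivity)).2
  rw [mul_pow, sq_abs]
  nlinarith [mul_le_mul_of_nonneg_left h4 (sq_nonneg (cos (P.ξ φ))),
    mul_nonneg hδ (sq_nonneg (cos (P.ξ φ)))]

theorem neg_G₂_ξ_ge (φ : ℝ) : P.B * (cos (P.ξ φ) - P.δ) ≤ |P.G₂ (φ, P.ξ φ)| := by
  have h := (abs_le.1 (P.G₂_near φ (P.ξ φ))).2
  rw [abs_of_neg (P.G₂_ξ_neg φ)]
  linarith

/-- In the model Iξ' = -I² A cos φ / (B cos ξ). Since |sin ξ| ≤ |sin φ|, |cos φ| ≤ cos ξ up to sign,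
and I² A ≤ qB gives |Iξ'| ≤ q; the margin up to (1+q)/2 pays for the perturbation. -/
theorem abs_mul_ξ'_le (φ : ℝ) : |P.I * P.ξ' φ| ≤ (1 + P.q) / 2 := by
  have hB := P.B_pos
  have hδ := P.δ_nonneg
  have hδ1 := P.δ_le
  have hδ2 := P.δ_le'
  have hq := P.q_nonneg
  have hq1 := P.q_lt_one
  have hc := P.cos_ge (P.abs_sin_le_of_G_eq_zero (P.G_ξ φ)) (P.cos_ξ_pos φ).le
  have h1 := P.abs_cos_le φ
  have h2 := P.neg_G₂_ξ_ge φ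
  have hn : 0 < |P.G₂ (φ, P.ξ φ)| := abs_pos.2 (P.G₂_ξ_neg φ).ne
  have h3 : |P.I| * |P.G₁ (φ, P.ξ φ)| ≤ P.q * P.B * |cos φ| + P.δ * P.B := by
    have h4 := P.G₁_near φ (P.ξ φ)
    calc |P.I| * |P.G₁ (φ, P.ξ φ)|
        = |P.I| * |(P.G₁ (φ, P.ξ φ) + P.I * P.A * cos φ) - P.I * P.A * cos φ| := by
          rw [add_sub_cancel_right]
      _ ≤ |P.I| * (|P.G₁ (φ, P.ξ φ) + P.I * P.A * cos φ| + |P.I| * P.A * |cos φ|) := by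
          gcongr
          refine (abs_sub _ _).trans ?_
          rw [abs_mul (P.I * P.A), abs_mul, abs_of_pos P.A_pos]
      _ = |P.I| * |P.G₁ (φ, P.ξ φ) + P.I * P.A * cos φ| + P.I ^ 2 * P.A * |cos φ| := by
          rw [← sq_abs P.I]; ring
      _ ≤ P.q * P.B * |cos φ| + P.δ * P.B := by
          have h5 := mul_le_mul_of_nonneg_right P.sq_mul_A_le (abs_nonneg (cos φ))
          linarith [abs_nonneg (P.G₁ (φ, P.ξ φ) + P.I * P.A * cos φ)]
  rw [ξ', mul_neg, abs_neg, abs_mul, abs_div, ← mul_div_assoc, div_le_iff₀ hn]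
  refine h3.trans (le_trans ?_ (mul_le_mul_of_nonneg_left h2 (by linarith)))
  -- Multiplying by cos ξ > 0 brings in `abs_cos_le`; the surplus (1-q)/2 · cos² ξ ≥ (1-q)²/4 then
  -- dominates all terms in δ.
  have key : P.q * |cos φ| + P.δ ≤ (1 + P.q) / 2 * (cos (P.ξ φ) - P.δ) := by
    have hc0 := P.cos_ξ_pos φ
    refine le_of_mul_le_mul_left ?_ hc0
    have h6 := mul_le_mul_of_nonneg_left h1 hq
    have h7 := mul_le_mul_of_nonneg_left (P.cos_sq_ge (P.abs_sin_le_of_G_eq_zero (P.G_ξ φ)))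
      (by linarith : 0 ≤ (1 - P.q) / 2)
    have h8 : cos (P.ξ φ) * P.δ ≤ P.δ := mul_le_of_le_one_left hδ (cos_le_one _)
    have h9 : P.q * P.δ ≤ P.δ := mul_le_of_le_one_left hδ hq1.le
    have h10 : P.q * (cos (P.ξ φ) * P.δ) ≤ cos (P.ξ φ) * P.δ :=
      mul_le_of_le_one_left (by positivity) hq1.le
    linarith
  nlinarith

theorem abs_ξ'_le (φ : ℝ) : |P.ξ' φ| ≤ 8 / (1 - P.q) := by
  have hB := P.B_pos
  have hδ := P.δ_nonneg
  have hδ2 := P.δ_le'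
  have hq := P.q_nonneg
  have hq1 := P.q_lt_one
  have hc := P.cos_ge (P.abs_sin_le_of_G_eq_zero (P.G_ξ φ)) (P.cos_ξ_pos φ).le
  have h2 := P.neg_G₂_ξ_ge φ
  have hn : 0 < |P.G₂ (φ, P.ξ φ)| := abs_pos.2 (P.G₂_ξ_neg φ).ne
  have h3 : |P.G₁ (φ, P.ξ φ)| ≤ 2 * P.B := by
    have h4 := P.G₁_near φ (P.ξ φ)
    have h5 : |P.I * P.A * cos φ| ≤ P.q * P.B := by
      rw [abs_mul, abs_mul, abs_of_pos P.A_pos]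
      exact (mul_le_of_le_one_right (mul_nonneg (abs_nonneg _) P.A_pos.le)
        (abs_cos_le_one _)).trans P.abs_mul_A_le
    calc |P.G₁ (φ, P.ξ φ)|
        = |(P.G₁ (φ, P.ξ φ) + P.I * P.A * cos φ) - P.I * P.A * cos φ| := by
          rw [add_sub_cancel_right]
      _ ≤ |P.G₁ (φ, P.ξ φ) + P.I * P.A * cos φ| + P.q * P.B := (abs_sub _ _).trans (by gcongr)
      _ ≤ P.δ * P.B + P.q * P.B := by
          have := mul_nonneg (abs_nonneg P.I) (abs_nonneg (P.G₁ (φ, P.ξ φ) + P.I * P.A * cos φ))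
          linarith
      _ ≤ 2 * P.B := by nlinarith
  have h6 : P.B * ((1 - P.q) / 4) ≤ |P.G₂ (φ, P.ξ φ)| := le_trans (by gcongr; linarith) h2
  have h7 : 0 < 1 - P.q := by linarith
  rw [ξ', abs_neg, abs_div, div_le_div_iff₀ hn h7]
  nlinarith

/-! ### The component of the crest through the maximum -/

theorem exists_isMax : ∃ m : ℝ × ℝ, ∀ y, P.L y ≤ P.L m := by
  have hp : (0 : ℝ) ≤ 2 * π := by positivity
  obtain ⟨m, -, hm⟩ := (isCompact_Icc.prod isCompact_Icc :
    IsCompact (Set.Icc (0 : ℝ) (2 * π) ×ˢ Set.Icc (0 : ℝ) (2 * π))).exists_isMaxOn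
      ⟨(0, 0), by simp [hp]⟩ P.continuous_L.continuousOn
  refine ⟨m, fun y => ?_⟩
  obtain ⟨φ, hφ, h1⟩ := Function.Periodic.exists_mem_Ico₀ (f := fun φ => P.L (φ, y.2))
    (fun φ => P.L_add_fst φ _) two_pi_pos y.1
  obtain ⟨s, hs, h2⟩ := Function.Periodic.exists_mem_Ico₀ (f := fun s => P.L (φ, s))
    (fun s => P.L_add_snd φ s) two_pi_pos y.2
  have h3 : P.L y = P.L (φ, s) := h1.trans h2
  rw [h3]
  exact hm ⟨⟨hφ.1, hφ.2.le⟩, hs.1, hs.2.le⟩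

theorem G_eq_zero_of_isMax {m : ℝ × ℝ} (hm : ∀ y, P.L y ≤ P.L m) : P.G m = 0 := by
  have h := IsLocalMax.hasFDerivAt_eq_zero (Eventually.of_forall hm) (P.hasFDerivAt_L m)
  have h1 := DFunLike.congr_fun h (1, 0)
  have h2 := DFunLike.congr_fun h (0, 1)
  simp at h1 h2
  rw [P.G_eq, h1, h2]
  simp

theorem cos_pos_of_isMax {m : ℝ × ℝ} (hm : ∀ y, P.L y ≤ P.L m) : 0 < cos m.2 := by
  have h1 := hm (m.1, 0)
  have h2 := (abs_le.1 (P.L_near m.1 m.2)).2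
  have h3 := P.δ_le'
  have h4 := P.q_nonneg
  have h5 : 0 ≤ P.B * (cos m.2 - 1 + P.δ) := by linarith
  have := nonneg_of_mul_nonneg_right h5 P.B_pos
  linarith

theorem G_periodic_snd (φ : ℝ) : Function.Periodic (fun s => P.G (φ, s)) (2 * π) :=
  fun s => P.G_add_snd φ s

theorem L_periodic_snd (φ : ℝ) : Function.Periodic (fun s => P.L (φ, s)) (2 * π) :=
  fun s => P.L_add_snd φ s

theorem G_ξ_add (φ : ℝ) (n : ℤ) : P.G (φ, P.ξ φ + 2 * π * n) = 0 := by
  have := (P.G_periodic_snd φ).int_mul n (P.ξ φ)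
  rw [mul_comm (2 * π)]
  exact this.trans (P.G_ξ φ)

theorem exists_eq_ξ_add {φ s : ℝ} (h : P.G (φ, s) = 0) (hs : 0 < cos s) :
    ∃ n : ℤ, s = P.ξ φ + 2 * π * n := by
  obtain ⟨n, hn, -⟩ := existsUnique_add_zsmul_mem_Ioc two_pi_pos s (-π)
  rw [zsmul_eq_mul] at hn
  have hG : P.G (φ, s + n * (2 * π)) = 0 := ((P.G_periodic_snd φ).int_mul n s).trans h
  have hc : 0 < cos (s + n * (2 * π)) := by rwa [cos_add_int_mul_two_pi]
  refine ⟨-n, ?_⟩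
  rw [← P.eq_ξ (s := s + n * (2 * π)) ?_ hG]
  · push_cast; ring
  · constructor
    · by_contra! hlt
      have := cos_nonpos_of_pi_div_two_le_of_le (x := -(s + n * (2 * π))) (by linarith)
        (by linarith [hn.1, pi_pos])
      rw [cos_neg] at this
      linarith
    · by_contra! hlt
      have := cos_nonpos_of_pi_div_two_le_of_le (x := s + n * (2 * π)) hlt
        (by linarith [hn.2, pi_pos])
      linarith

/-- The union of the components of `{G = 0}` that contain a maximum point of `L`. -/
def maxCrest : Set (ℝ × ℝ) :=
  {x | ∃ m : ℝ × ℝ, (∀ y : ℝ × ℝ, P.L y ≤ P.L m) ∧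
    x ∈ connectedComponentIn {x | P.G x = 0} m}

/-- cos s is continuous on a connected component, never zero on the crest, and positive at a
maximum, so it stays positive. Conversely each translate of the graph of `ξ` is connected and
contains a 2π-translate of a maximum point. -/
theorem mem_maxCrest_iff {φ s : ℝ} :
    (φ, s) ∈ P.maxCrest ↔ ∃ n : ℤ, s = P.ξ φ + 2 * π * n := by
  constructor
  · rintro ⟨m, hm, hx⟩
    have hsub := connectedComponentIn_subset {x | P.G x = 0} m
    refine P.exists_eq_ξ_add (hsub hx) ?_
    have hpre := (isPreconnected_connectedComponentIn (x := m) (F := {x | P.G x = 0})).image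
      (fun x : ℝ × ℝ => cos x.2) (by fun_prop)
    by_contra! hneg
    obtain ⟨y, hy, hy0⟩ := hpre.ordConnected.out ⟨_, hx, rfl⟩
      ⟨m, mem_connectedComponentIn (P.G_eq_zero_of_isMax hm), rfl⟩
      ⟨hneg, (P.cos_pos_of_isMax hm).le⟩
    have h1 := P.cos_sq_ge (P.abs_sin_le_of_G_eq_zero (φ := y.1) (s := y.2) (hsub hy))
    simp only at hy0
    rw [hy0] at h1
    linarith [P.q_lt_one]
  · rintro ⟨n, rfl⟩
    obtain ⟨m, hm⟩ := P.exists_isMax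
    obtain ⟨n₀, hn₀⟩ := P.exists_eq_ξ_add (φ := m.1) (s := m.2) (P.G_eq_zero_of_isMax hm)
      (P.cos_pos_of_isMax hm)
    have hL : P.L (m.1, P.ξ m.1 + 2 * π * n) = P.L m := by
      have h := (P.L_periodic_snd m.1).int_mul (n - n₀) m.2
      have e : m.2 + ((n - n₀ : ℤ) : ℝ) * (2 * π) = P.ξ m.1 + 2 * π * n := by
        rw [hn₀]; push_cast; ring
      simp only [e] at h
      exact h
    refine ⟨(m.1, P.ξ m.1 + 2 * π * n), fun y => hL ▸ hm y, ?_⟩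
    have hpre : IsPreconnected (Set.range fun t : ℝ => (t, P.ξ t + 2 * π * n)) :=
      isPreconnected_range (continuous_id.prodMk (P.continuous_ξ.add continuous_const))
    refine hpre.subset_connectedComponentIn ⟨m.1, rfl⟩ ?_ ⟨φ, rfl⟩
    rintro _ ⟨t, rfl⟩
    exact P.G_ξ_add t n

end NearCosine

/-! ### Zeros of functions C¹-close to the sine. -/

theorem half_le_cos {u : ℝ} (h : |u| ≤ π / 3) : 1 / 2 ≤ cos u := by
  rw [← cos_pi_div_three, ← cos_abs u]
  exact cos_le_cos_of_nonneg_of_le_pi (abs_nonneg _) (by linarith [pi_pos]) h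

theorem abs_le_two_mul_of_abs_sin_le {x ν : ℝ} (hx : |x| ≤ π / 2) (h : |sin x| ≤ ν) :
    |x| ≤ 2 * ν := by
  have h1 := mul_abs_le_abs_sin hx
  have h2 : 1 / 2 * |x| ≤ 2 / π * |x| := by
    gcongr ?_ * |x|
    rw [div_le_div_iff₀ two_pos pi_pos]
    linarith [pi_le_four]
  linarith

/-- A function `C¹`-close to the sine has a unique, non-degenerate zero near `0`. -/
theorem exists_zero_of_near_sin {N N' : ℝ → ℝ} {ν : ℝ} (hd : ∀ t, HasDerivAt N (N' t) t)
    (hν : ν ≤ 1 / 4) (h0 : ∀ t, |N t - sin t| ≤ ν) (h1 : ∀ t, |N' t - cos t| ≤ 1 / 4) :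
    ∃ x, |x| ≤ 2 * ν ∧ -(π / 3) < x ∧ x < π / 3 ∧ N x = 0 ∧ 0 < N' x ∧
      (∀ t, -(π / 3) ≤ t → t < x → N t < 0) ∧ ∀ t, x < t → t ≤ 2 * π / 3 → 0 < N t := by
  have hp := pi_pos
  have hc : Continuous N := continuous_iff_continuousAt.2 fun t => (hd t).continuousAt
  -- On |t| ≤ π/3 cos t ≥ 1/2 makes N increasing; on [π/3, 2π/3] sin t ≥ 1/2 makes N positive. Both
  -- beat the error 1/4.
  have hs : ∀ t, π / 3 ≤ t → t ≤ 2 * π / 3 → 1 / 2 ≤ sin t := by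
    intro t h2 h3
    rw [← cos_sub_pi_div_two]
    exact half_le_cos (abs_le.2 ⟨by linarith, by linarith⟩)
  have hpos : ∀ t, π / 3 ≤ t → t ≤ 2 * π / 3 → 0 < N t := by
    intro t h2 h3
    linarith [hs t h2 h3, (abs_le.1 (h0 t)).1]
  have hneg : N (-(π / 3)) < 0 := by
    have h2 := (abs_le.1 (h0 (-(π / 3)))).2
    rw [sin_neg] at h2
    linarith [hs (π / 3) le_rfl (by linarith)]
  have hder : ∀ t ∈ Set.Icc (-(π / 3)) (π / 3), 0 < N' t := by
    intro t ht
    linarith [half_le_cos (abs_le.2 ht), (abs_le.1 (h1 t)).1]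
  have hmono : StrictMonoOn N (Set.Icc (-(π / 3)) (π / 3)) := by
    refine strictMonoOn_of_deriv_pos (convex_Icc _ _) hc.continuousOn fun t ht => ?_
    rw [(hd t).deriv]
    exact hder t (interior_subset ht)
  have hpos' := hpos (π / 3) le_rfl (by linarith)
  obtain ⟨x, hx, hx0⟩ := intermediate_value_Icc (by linarith) hc.continuousOn ⟨hneg.le, hpos'.le⟩
  have hx1 : x ≠ -(π / 3) := by rintro rfl; exact hneg.ne hx0
  have hx2 : x ≠ π / 3 := by rintro rfl; exact hpos'.ne' hx0
  refine ⟨x, ?_, lt_of_le_of_ne hx.1 hx1.symm, lt_of_le_of_ne hx.2 hx2, hx0, hder x hx, ?_, ?_⟩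
  · refine abs_le_two_mul_of_abs_sin_le (abs_le.2 ⟨by linarith [hx.1], by linarith [hx.2]⟩) ?_
    have := h0 x
    rwa [hx0, zero_sub, abs_neg] at this
  · intro t h2 h3
    rw [← hx0]
    exact hmono ⟨h2, by linarith [hx.2]⟩ hx h3
  · intro t h2 h3
    rcases le_total t (π / 3) with h4 | h4
    · rw [← hx0]
      exact hmono hx ⟨by linarith [hx.1], h4⟩ h2
    · exact hpos t h4 h3

/-- A periodic function `C¹`-close to the sine has the sign pattern of the sine. -/
theorem exists_zeros_of_near_sin {N N' : ℝ → ℝ} {ν : ℝ} (hd : ∀ t, HasDerivAt N (N' t) t)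
    (hper : Function.Periodic N (2 * π)) (hν : ν ≤ 1 / 4) (h0 : ∀ t, |N t - sin t| ≤ ν)
    (h1 : ∀ t, |N' t - cos t| ≤ 1 / 4) :
    ∃ x y, |x| ≤ 2 * ν ∧ |y - π| ≤ 2 * ν ∧ x < y ∧ y < x + 2 * π ∧ N x = 0 ∧ N y = 0 ∧
      0 < N' x ∧ N' y < 0 ∧ (∀ t ∈ Set.Ioo x y, 0 < N t) ∧
      ∀ t ∈ Set.Ioo y (x + 2 * π), N t < 0 := by
  have hp := pi_pos
  obtain ⟨x, hx, hx1, hx2, hx0, hx', hxn, hxp⟩ := exists_zero_of_near_sin hd hν h0 h1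
  -- The zero near π is found on -N(t + π), which is again close to the sine.
  obtain ⟨z, hz, hz1, hz2, hz0, hz', hzn, hzp⟩ := exists_zero_of_near_sin
    (N := fun t => -N (t + π)) (N' := fun t => -N' (t + π)) (ν := ν)
    (fun t => ((hd (t + π)).comp_add_const t π).neg) hν
    (fun t => by
      have := h0 (t + π)
      rw [sin_add_pi] at this
      rw [← abs_neg]
      convert this using 2
      ring)
    (fun t => by
      have := h1 (t + π)
      rw [cos_add_pi] at this
      rw [← abs_neg]
      convert this using 2
      ring)
  refine ⟨x, z + π, hx, by simpa using hz, by linarith, by linarith, hx0, by simpa using hz0, hx',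
    by simpa using hz', ?_, ?_⟩
  · intro t ht
    rcases le_total t (2 * π / 3) with h | h
    · exact hxp t ht.1 h
    · have := hzn (t - π) (by linarith) (by linarith [ht.2])
      simpa using this
  · intro t ht
    rcases le_total t (5 * π / 3) with h | h
    · have := hzp (t - π) (by linarith [ht.1]) (by linarith)
      simpa using this
    · rw [← hper.sub_eq t]
      exact hxn _ (by linarith) (by linarith [ht.2])

namespace NearCosine

variable (P : NearCosine)

/-- On the interval holding both points sin has slope at least (1-q)/2. The error γ is separate from
δB because the final estimate is in (ρ+r)², and δB may be larger than that. -/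
theorem mul_abs_sub_arcsin_le {γ : ℝ} (φ : ℝ)
    (hγ : ∀ s, |P.G (φ, s) + (P.I * P.A * sin φ + P.B * sin s)| ≤ γ) :
    P.B * |P.ξ φ - -arcsin (P.I * P.A / P.B * sin φ)| ≤ 2 / (1 - P.q) * γ := by
  have hB := P.B_pos
  have hq := P.q_nonneg
  have hq1 := P.q_lt_one
  set ξ₀ := arcsin (P.I * P.A / P.B * sin φ) with hξ₀
  set s₁ := arcsin ((1 + P.q) / 2) with hs₁
  have hse : sin s₁ = (1 + P.q) / 2 := sin_arcsin (by linarith) (by linarith)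
  have hlt : s₁ < π / 2 := arcsin_lt_pi_div_two.2 (by linarith)
  have hab : |P.I * P.A / P.B * sin φ| ≤ P.q := by
    rw [div_mul_eq_mul_div, abs_div, abs_of_pos hB, div_le_iff₀ hB]
    exact P.abs_mul_sin_le φ
  have hab' := abs_le.1 hab
  have hsin : sin ξ₀ = P.I * P.A / P.B * sin φ := sin_arcsin (by linarith) (by linarith)
  have hcos : ∀ s ∈ Set.Icc (-s₁) s₁, (1 - P.q) / 2 ≤ cos s := by
    intro s hs
    refine P.cos_ge (abs_le.2 ⟨?_, ?_⟩)
      (cos_nonneg_of_neg_pi_div_two_le_of_le (by linarith [hs.1]) (by linarith [hs.2]))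
    · rw [← hse, ← sin_neg]
      exact sin_le_sin_of_le_of_le_pi_div_two (by linarith) (by linarith [hs.2]) hs.1
    · rw [← hse]
      exact sin_le_sin_of_le_of_le_pi_div_two (by linarith [hs.1]) hlt.le hs.2
  have hm1 := P.mem_Icc_of_G_eq_zero (P.ξ_mem φ) (P.G_ξ φ)
  have hm2 : -ξ₀ ∈ Set.Icc (-s₁) s₁ := by
    constructor
    · exact neg_le_neg (monotone_arcsin (by linarith))
    · rw [hξ₀, ← arcsin_neg]
      exact monotone_arcsin (by linarith)
  have hmv := Convex.mul_sub_le_image_sub_of_le_deriv (convex_Icc (-s₁) s₁) (f := sin)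
    continuous_sin.continuousOn differentiable_sin.differentiableOn (C := (1 - P.q) / 2)
    (fun s hs => by rw [Real.deriv_sin]; exact hcos s (interior_subset hs))
  have h1 : (1 - P.q) / 2 * |P.ξ φ - -ξ₀| ≤ |sin (P.ξ φ) - sin (-ξ₀)| := by
    rcases le_total (-ξ₀) (P.ξ φ) with h | h
    · rw [abs_of_nonneg (sub_nonneg.2 h)]
      exact (hmv _ hm2 _ hm1 h).trans (le_abs_self _)
    · rw [abs_sub_comm, abs_of_nonneg (sub_nonneg.2 h), abs_sub_comm]
      exact (hmv _ hm1 _ hm2 h).trans (le_abs_self _)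
  have h2 : P.B * |sin (P.ξ φ) - sin (-ξ₀)| ≤ γ := by
    have h3 := hγ (P.ξ φ)
    rw [P.G_ξ, zero_add] at h3
    refine le_of_eq_of_le ?_ h3
    rw [sin_neg, hsin, ← abs_of_pos hB, ← abs_mul, abs_of_pos hB]
    congr 1
    field_simp
    ring
  rw [div_mul_eq_mul_div, le_div_iff₀ (by linarith)]
  have := mul_le_mul_of_nonneg_left h1 hB.le
  linarith

/-! ### The change of variable along the crest -/

/-- The map `ψ ↦ ψ - I ξ(ψ)`. -/
def T (ψ : ℝ) : ℝ := ψ - P.I * P.ξ ψ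

theorem hasDerivAt_T (ψ : ℝ) : HasDerivAt P.T (1 - P.I * P.ξ' ψ) ψ :=
  (hasDerivAt_id ψ).sub ((P.hasDerivAt_ξ ψ).const_mul P.I)

theorem T_deriv_pos (ψ : ℝ) : 0 < 1 - P.I * P.ξ' ψ := by
  have := (abs_le.1 (P.abs_mul_ξ'_le ψ)).2
  linarith [P.q_lt_one]

theorem strictMono_T : StrictMono P.T :=
  strictMono_of_deriv_pos fun ψ => by rw [(P.hasDerivAt_T ψ).deriv]; exact P.T_deriv_pos ψ

theorem abs_mul_ξ_le (ψ : ℝ) : |P.I * P.ξ ψ| ≤ |P.I| * (π / 2) := by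
  rw [abs_mul]
  exact mul_le_mul_of_nonneg_left (P.abs_ξ_lt ψ).le (abs_nonneg _)

theorem surjective_T : Function.Surjective P.T := by
  have hc : Continuous P.T := continuous_iff_continuousAt.2 fun t => (P.hasDerivAt_T t).continuousAt
  refine hc.surjective ?_ ?_
  · refine tendsto_atTop_mono (f := fun ψ => ψ + -(|P.I| * (π / 2))) (fun ψ => ?_)
      (tendsto_atTop_add_const_right _ _ tendsto_id)
    have := (abs_le.1 (P.abs_mul_ξ_le ψ)).2
    simp only [T]
    linarith
  · refine tendsto_atBot_mono (f := fun ψ => ψ + (|P.I| * (π / 2))) (fun ψ => ?_)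
      (tendsto_atBot_add_const_right _ _ tendsto_id)
    have := (abs_le.1 (P.abs_mul_ξ_le ψ)).1
    simp only [T]
    linarith

/-- The inverse of `T`. -/
def Ψ : ℝ ≃o ℝ := (StrictMono.orderIsoOfSurjective P.T P.strictMono_T P.surjective_T).symm

theorem T_Ψ (θ : ℝ) : P.T (P.Ψ θ) = θ :=
  (StrictMono.orderIsoOfSurjective P.T P.strictMono_T P.surjective_T).apply_symm_apply θ

theorem Ψ_T (ψ : ℝ) : P.Ψ (P.T ψ) = ψ := P.strictMono_T.injective (P.T_Ψ _)

theorem T_add (ψ : ℝ) : P.T (ψ + 2 * π) = P.T ψ + 2 * π := by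
  simp only [T, P.ξ_periodic ψ]
  ring

theorem Ψ_add (θ : ℝ) : P.Ψ (θ + 2 * π) = P.Ψ θ + 2 * π :=
  P.strictMono_T.injective (by rw [T_Ψ, T_add, T_Ψ])

theorem continuous_Ψ : Continuous P.Ψ := P.Ψ.continuous

theorem hasDerivAt_Ψ (θ : ℝ) : HasDerivAt P.Ψ (1 - P.I * P.ξ' (P.Ψ θ))⁻¹ θ :=
  HasDerivAt.of_local_left_inverse P.continuous_Ψ.continuousAt (P.hasDerivAt_T _)
    (P.T_deriv_pos _).ne' (Eventually.of_forall P.T_Ψ)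

/-- `τ` has least absolute value among the parameters at which `(φ - Iτ, s - τ)` is on the
crest through the maximum. -/
def IsLeast (φ s τ : ℝ) : Prop :=
  (φ - P.I * τ, s - τ) ∈ P.maxCrest ∧
    ∀ τ' : ℝ, (φ - P.I * τ', s - τ') ∈ P.maxCrest → |τ| ≤ |τ'|

/-- The parameter at which `(φ - Iτ, s - τ)` is on the graph of `ξ`. -/
def τ₀ (φ s : ℝ) : ℝ := s - P.ξ (P.Ψ (φ - P.I * s))

theorem sub_mul_τ₀ (φ s : ℝ) : φ - P.I * P.τ₀ φ s = P.Ψ (φ - P.I * s) := by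
  have h := P.T_Ψ (φ - P.I * s)
  rw [T] at h
  rw [τ₀]
  linarith

theorem sub_τ₀ (φ s : ℝ) : s - P.τ₀ φ s = P.ξ (P.Ψ (φ - P.I * s)) := by
  rw [τ₀]; ring

theorem mem_maxCrest_τ₀ (φ s : ℝ) : (φ - P.I * P.τ₀ φ s, s - P.τ₀ φ s) ∈ P.maxCrest := by
  rw [sub_mul_τ₀, sub_τ₀, mem_maxCrest_iff]
  exact ⟨0, by simp⟩

/-- On the sheet n = 0, injectivity of `T` forces τ = `τ₀`. There |τ₀| < π, as |s| ≤ π/2 and |ξ| <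
π/2; on any other sheet |τ| > 2π - π. -/
theorem abs_τ₀_lt {φ s τ : ℝ} (hs : |s| ≤ π / 2) (h : (φ - P.I * τ, s - τ) ∈ P.maxCrest)
    (hne : τ ≠ P.τ₀ φ s) : |P.τ₀ φ s| < |τ| := by
  rw [mem_maxCrest_iff] at h
  obtain ⟨n, hn⟩ := h
  have hs' := abs_le.1 hs
  rcases eq_or_ne n 0 with rfl | hn0
  · exfalso
    apply hne
    rw [Int.cast_zero, mul_zero, add_zero] at hn
    have h1 : P.Ψ (φ - P.I * s) = φ - P.I * τ := by
      rw [← P.Ψ_T (φ - P.I * τ), T, ← hn]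
      ring_nf
    rw [τ₀, h1, ← hn]
    ring
  · have h1 := abs_lt.1 (P.abs_ξ_lt (φ - P.I * τ))
    have h2 := abs_lt.1 (P.abs_ξ_lt (P.Ψ (φ - P.I * s)))
    have h3 : |P.τ₀ φ s| < π := by
      rw [τ₀, abs_lt]
      constructor <;> linarith
    refine h3.trans ?_
    have hp := pi_pos
    rcases lt_or_gt_of_ne hn0 with h4 | h4
    · have h5 : (n : ℝ) ≤ -1 := by exact_mod_cast (by omega : n ≤ -1)
      have h6 : 2 * π * n ≤ 2 * π * -1 := by gcongr
      exact lt_of_lt_of_le (by linarith) (le_abs_self τ)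
    · have h5 : (1 : ℝ) ≤ n := by exact_mod_cast (by omega : 1 ≤ n)
      have h6 : 2 * π * 1 ≤ 2 * π * n := by gcongr
      exact lt_of_lt_of_le (by linarith) (neg_le_abs τ)

theorem isLeast_iff {φ s τ : ℝ} (hs : |s| ≤ π / 2) : P.IsLeast φ s τ ↔ τ = P.τ₀ φ s := by
  constructor
  · rintro ⟨h1, h2⟩
    by_contra hne
    exact absurd (h2 _ (P.mem_maxCrest_τ₀ φ s)) (not_le.2 (P.abs_τ₀_lt hs h1 hne))
  · rintro rfl
    refine ⟨P.mem_maxCrest_τ₀ φ s, fun τ' h => ?_⟩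
    by_cases hne : τ' = P.τ₀ φ s
    · rw [hne]
    · exact (P.abs_τ₀_lt hs h hne).le

/-! ### The reduced function -/

/-- The restriction of `L` to the crest, as a function of `θ = T ψ`. -/
def reduced (θ : ℝ) : ℝ := P.L (P.Ψ θ, P.ξ (P.Ψ θ))

/-- The derivative of `ψ ↦ L₁(ψ, ξ(ψ))`. -/
def M' (ψ : ℝ) : ℝ := P.L₁₁ (ψ, P.ξ ψ) + P.L₁₂ (ψ, P.ξ ψ) * P.ξ' ψ

theorem hasDerivAt_L₁_ξ (ψ : ℝ) : HasDerivAt (fun ψ => P.L₁ (ψ, P.ξ ψ)) (P.M' ψ) ψ := by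
  have h := (P.hasFDerivAt_L₁ (ψ, P.ξ ψ)).comp_hasDerivAt ψ
    ((hasDerivAt_id ψ).prodMk (P.hasDerivAt_ξ ψ))
  refine h.congr_deriv ?_
  simp [M']

/-- On the crest L₂ = -I L₁, so ψ ↦ L(ψ, ξ(ψ)) has derivative L₁ + L₂ξ' = L₁(1 - Iξ'), and the
factor cancels against T'. -/
theorem hasDerivAt_reduced (θ : ℝ) :
    HasDerivAt P.reduced (P.L₁ (P.Ψ θ, P.ξ (P.Ψ θ))) θ := by
  have h1 := (P.hasFDerivAt_L (P.Ψ θ, P.ξ (P.Ψ θ))).comp_hasDerivAt (P.Ψ θ)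
    ((hasDerivAt_id (P.Ψ θ)).prodMk (P.hasDerivAt_ξ (P.Ψ θ)))
  refine (h1.comp θ (P.hasDerivAt_Ψ θ)).congr_deriv ?_
  have hG := P.G_ξ (P.Ψ θ)
  rw [P.G_eq] at hG
  have hne := (P.T_deriv_pos (P.Ψ θ)).ne'
  rw [← div_eq_mul_inv, div_eq_iff hne]
  simp
  linear_combination P.ξ' (P.Ψ θ) * hG

theorem deriv_reduced : deriv P.reduced = fun θ => P.L₁ (P.Ψ θ, P.ξ (P.Ψ θ)) :=
  funext fun θ => (P.hasDerivAt_reduced θ).deriv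

theorem hasDerivAt_deriv_reduced (θ : ℝ) :
    HasDerivAt (deriv P.reduced) (P.M' (P.Ψ θ) * (1 - P.I * P.ξ' (P.Ψ θ))⁻¹) θ := by
  rw [deriv_reduced]
  exact (P.hasDerivAt_L₁_ξ (P.Ψ θ)).comp θ (P.hasDerivAt_Ψ θ)

theorem contDiff_reduced : ContDiff ℝ 2 P.reduced := by
  rw [show (2 : WithTop ℕ∞) = 1 + 1 by norm_num, contDiff_succ_iff_deriv]
  refine ⟨fun θ => (P.hasDerivAt_reduced θ).differentiableAt, by simp, ?_⟩
  rw [contDiff_one_iff_deriv]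
  refine ⟨fun θ => (P.hasDerivAt_deriv_reduced θ).differentiableAt, ?_⟩
  rw [funext fun θ => (P.hasDerivAt_deriv_reduced θ).deriv]
  have h : Continuous fun ψ => (ψ, P.ξ ψ) := continuous_id.prodMk P.continuous_ξ
  have hM : Continuous P.M' :=
    (P.continuous_L₁₁.comp h).add ((P.continuous_L₁₂.comp h).mul P.continuous_ξ')
  refine (hM.comp P.continuous_Ψ).mul (Continuous.inv₀ ?_ fun θ => (P.T_deriv_pos _).ne')
  exact continuous_const.sub (continuous_const.mul (P.continuous_ξ'.comp P.continuous_Ψ))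

theorem reduced_periodic : Function.Periodic P.reduced (2 * π) := fun θ => by
  rw [reduced, reduced, Ψ_add, P.ξ_periodic, P.L_add_fst]

theorem abs_mul_ξ_le_of_abs_sin_le {x : ℝ} (hx : |sin x| ≤ 2 * P.δ) :
    |P.I * P.ξ x| ≤ 6 * P.δ * |P.I| := by
  have h := abs_le_two_mul_of_abs_sin_le (P.abs_ξ_lt x).le (P.abs_sin_ξ_le x)
  rw [abs_mul, mul_comm]
  gcongr
  linarith

/-- -L₁(ψ, ξ(ψ))/A is C¹-close to the sine, and the increasing map `T` carries its zeros and signs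
to those of the derivative of `reduced`. A zero x moves to x - Iξ(x), with |x| ≤ 2δ and |ξ(x)| ≤ 6δ;
similarly near π. -/
theorem exists_critical_points : ∃ θM θm : ℝ, θM < θm ∧ θm < θM + 2 * π ∧
    |θM| ≤ 6 * P.δ * (1 + |P.I|) ∧ |θm - π| ≤ 6 * P.δ * (1 + |P.I|) ∧
    deriv P.reduced θM = 0 ∧ deriv (deriv P.reduced) θM < 0 ∧
    deriv P.reduced θm = 0 ∧ 0 < deriv (deriv P.reduced) θm ∧
    (∀ θ ∈ Set.Ioo θM θm, deriv P.reduced θ < 0) ∧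
    (∀ θ ∈ Set.Ioo θm (θM + 2 * π), 0 < deriv P.reduced θ) ∧
    StrictAntiOn P.reduced (Set.Icc θM θm) ∧
    StrictMonoOn P.reduced (Set.Icc θm (θM + 2 * π)) := by
  have hA := P.A_pos
  have hδ0 := P.δ_nonneg
  have hδ := P.δ_le
  have hδ' := P.δ_le'
  have hq := P.q_nonneg
  have hq1 : 0 < 1 - P.q := by linarith [P.q_lt_one]
  obtain ⟨x, y, hx, hy, hxy, hyx, hx0, hy0, hx', hy', hp, hn⟩ := exists_zeros_of_near_sin
    (N := fun ψ => -P.L₁ (ψ, P.ξ ψ) / P.A) (N' := fun ψ => -P.M' ψ / P.A) (ν := P.δ)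
    (fun ψ => (P.hasDerivAt_L₁_ξ ψ).neg.div_const _)
    (fun ψ => by simp only [P.ξ_periodic ψ, P.L₁_add_fst]) (by linarith)
    (fun ψ => by
      rw [div_sub' hA.ne', abs_div, abs_of_pos hA, div_le_iff₀ hA, ← abs_neg]
      refine (congrArg _ ?_).trans_le (P.L₁_near ψ (P.ξ ψ))
      ring)
    (fun ψ => by
      rw [div_sub' hA.ne', abs_div, abs_of_pos hA, div_le_iff₀ hA, ← abs_neg]
      have h1 := P.L₁₁_near ψ (P.ξ ψ)
      have h2 := P.L₁₂_near ψ (P.ξ ψ)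
      have h3 : |P.L₁₂ (ψ, P.ξ ψ) * P.ξ' ψ| ≤ P.δ * P.A * (8 / (1 - P.q)) := by
        rw [abs_mul]
        exact mul_le_mul h2 (P.abs_ξ'_le ψ) (abs_nonneg _) (by positivity)
      have h4 : P.δ * (8 / (1 - P.q)) ≤ 8 / 100 := by
        rw [← mul_div_assoc, div_le_iff₀ hq1]
        linarith
      have h5 := mul_le_mul_of_nonneg_right h4 hA.le
      calc |-(-P.M' ψ - P.A * cos ψ)|
          = |(P.L₁₁ (ψ, P.ξ ψ) + P.A * cos ψ) + P.L₁₂ (ψ, P.ξ ψ) * P.ξ' ψ| := by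
            rw [M']; ring_nf
        _ ≤ P.δ * P.A + P.δ * P.A * (8 / (1 - P.q)) := (abs_add_le _ _).trans (add_le_add h1 h3)
        _ ≤ 1 / 4 * P.A := by nlinarith)
  have hd0 : ∀ ψ, deriv P.reduced (P.T ψ) = P.L₁ (ψ, P.ξ ψ) := fun ψ => by
    rw [(P.hasDerivAt_reduced _).deriv, Ψ_T]
  have hdd : ∀ ψ, deriv (deriv P.reduced) (P.T ψ) = P.M' ψ * (1 - P.I * P.ξ' ψ)⁻¹ := fun ψ => by
    rw [(P.hasDerivAt_deriv_reduced _).deriv, Ψ_T]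
  have hL0 : ∀ {ψ}, -P.L₁ (ψ, P.ξ ψ) / P.A = 0 → P.L₁ (ψ, P.ξ ψ) = 0 := fun h => by
    simpa [hA.ne'] using h
  have hΨ : ∀ {u v θ}, θ ∈ Set.Ioo (P.T u) (P.T v) → P.Ψ θ ∈ Set.Ioo u v := by
    intro u v θ hθ
    rw [← P.T_Ψ θ] at hθ
    exact ⟨P.strictMono_T.lt_iff_lt.1 hθ.1, P.strictMono_T.lt_iff_lt.1 hθ.2⟩
  have hneg : ∀ θ ∈ Set.Ioo (P.T x) (P.T y), deriv P.reduced θ < 0 := by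
    intro θ hθ
    have h1 := hp _ (hΨ hθ)
    rw [deriv_reduced]
    have := (div_pos_iff_of_pos_right hA).1 h1
    linarith
  have hpos : ∀ θ ∈ Set.Ioo (P.T y) (P.T x + 2 * π), 0 < deriv P.reduced θ := by
    intro θ hθ
    rw [← T_add] at hθ
    have h1 := hn _ (hΨ hθ)
    rw [deriv_reduced]
    have := (div_neg_iff.1 h1)
    rcases this with h | h
    · linarith [h.2]
    · linarith [h.1]
  have hc : Continuous P.reduced := P.contDiff_reduced.continuous
  refine ⟨P.T x, P.T y, P.strictMono_T hxy, by rw [← T_add]; exact P.strictMono_T hyx, ?_, ?_,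
    by rw [hd0, hL0 hx0], ?_, by rw [hd0, hL0 hy0], ?_, hneg, hpos, ?_, ?_⟩
  · have h1 := P.abs_mul_ξ_le_of_abs_sin_le (abs_sin_le_abs.trans hx)
    rw [T]
    refine (abs_sub _ _).trans ?_
    linarith
  · have h2 : |sin y| ≤ 2 * P.δ := by
      rw [← abs_neg, ← sin_sub_pi]
      exact abs_sin_le_abs.trans hy
    have h1 := P.abs_mul_ξ_le_of_abs_sin_le h2
    rw [T, sub_right_comm]
    refine (abs_sub _ _).trans ?_
    linarith
  · rw [hdd]
    have := (div_pos_iff_of_pos_right hA).1 hx'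
    exact mul_neg_of_neg_of_pos (by linarith) (inv_pos.2 (P.T_deriv_pos x))
  · rw [hdd]
    refine mul_pos ?_ (inv_pos.2 (P.T_deriv_pos y))
    rcases div_neg_iff.1 hy' with h | h
    · linarith [h.2]
    · linarith [h.1]
  · refine strictAntiOn_of_deriv_neg (convex_Icc _ _) hc.continuousOn fun θ hθ => ?_
    rw [interior_Icc] at hθ
    exact hneg θ hθ
  · refine strictMonoOn_of_deriv_pos (convex_Icc _ _) hc.continuousOn fun θ hθ => ?_
    rw [interior_Icc] at hθ
    exact hpos θ hθ

end NearCosine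

/-! ### Coefficient estimates uniform in I. -/

theorem summable_abs_of_le {d : ℕ × ℕ → ℝ} {C y : ℝ} (m : ℕ) (hC : 0 ≤ C) (hy : 0 ≤ y)
    (hy2 : y ≤ 1 / 2)
    (hd : ∀ n : ℕ × ℕ, |d n| ≤ C * ((1 + n.1 + n.2 : ℝ) ^ m * y ^ (n.1 + n.2))) :
    Summable fun n => |d n| := by
  refine Summable.of_nonneg_of_le (fun _ => abs_nonneg _) (fun n => (hd n).trans ?_)
    ((summable_pow_mul_half_pow m).mul_left C)
  gcongr

theorem summable_mul_abs_of_le {d : ℕ × ℕ → ℝ} {C y : ℝ} (m : ℕ) (hC : 0 ≤ C) (hy : 0 ≤ y)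
    (hy2 : y ≤ 1 / 2)
    (hd : ∀ n : ℕ × ℕ, |d n| ≤ C * ((1 + n.1 + n.2 : ℝ) ^ m * y ^ (n.1 + n.2))) :
    Summable fun n : ℕ × ℕ => (1 + n.1 + n.2 : ℝ) * |d n| := by
  have h := summable_abs_of_le (d := fun n => (1 + n.1 + n.2 : ℝ) * d n) (m + 1) hC hy hy2
    fun n => by
      have h0 : (0 : ℝ) ≤ 1 + n.1 + n.2 := by positivity
      rw [abs_mul, abs_of_nonneg h0]
      refine (mul_le_mul_of_nonneg_left (hd n) h0).trans_eq ?_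
      ring
  refine h.congr fun n => ?_
  rw [abs_mul, abs_of_nonneg (by positivity : (0 : ℝ) ≤ 1 + n.1 + n.2)]

theorem abs_trigSeries_sub_le {d τ : ℕ × ℕ → ℝ} {C y : ℝ} {m : ℕ} (hm : m ≤ 2) (hC : 0 ≤ C)
    (hy : 0 ≤ y) (hy2 : y ≤ 1 / 2)
    (hd : ∀ n : ℕ × ℕ, |d n| ≤ C * ((1 + n.1 + n.2 : ℝ) ^ m * y ^ (n.1 + n.2))) (x : ℝ × ℝ) :
    |trigSeries d τ x - (d (0, 0) * cos (τ (0, 0)) + d (1, 0) * cos (x.1 - τ (1, 0))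
      + d (0, 1) * cos (x.2 + τ (0, 1)))| ≤ C * tailConst * y ^ 2 := by
  rw [trigSeries_eq_add_tail (summable_abs_of_le m hC hy hy2 hd), add_sub_cancel_left]
  refine abs_trigSeries_tail_le hC hy hy2 (fun n _ => (hd n).trans ?_) x
  gcongr
  have h1 : (0 : ℝ) ≤ n.1 := by positivity
  have h2 : (0 : ℝ) ≤ n.2 := by positivity
  linarith

/-- A bound for the harmonics of order at least two. -/
def tailBound (α ε : ℝ) : ℝ := 216 * α * tailConst * (5 * ε) ^ 2

/-- The phases of the first derivatives. -/
def phase₁ (σ : ℕ → ℕ → ℝ) (n : ℕ × ℕ) : ℝ := σ n.1 n.2 - π / 2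

/-- The phases of the second derivatives. -/
def phase₂ (σ : ℕ → ℕ → ℝ) (n : ℕ × ℕ) : ℝ := phase₁ σ n - π / 2

/-- The smallness conditions on the Fourier coefficients under which the Melnikov potential is
close to a sum of two cosines. -/
structure FourierBounds (a σ : ℕ → ℕ → ℝ) (α ε δ q : ℝ) : Prop where
  α_nonneg : 0 ≤ α
  ε_nonneg : 0 ≤ ε
  ε_le : 5 * ε ≤ 1 / 2
  δ_nonneg : 0 ≤ δ
  q_nonneg : 0 ≤ q
  q_lt_one : q < 1
  δ_le : δ ≤ (1 - q) ^ 2 / 100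
  abs_le : ∀ k l, |a k l| ≤ α * ε ^ (k + l)
  pos₁ : 0 < a 1 0
  pos₂ : 0 < a 0 1
  σ₁ : σ 1 0 = 0
  σ₂ : σ 0 1 = 0
  kappa_mul_le : kappa * a 1 0 ≤ q * a 0 1
  tail_le₁ : tailBound α ε ≤ δ * a 1 0
  tail_le₂ : tailBound α ε ≤ δ * a 0 1

namespace FourierBounds

variable {a σ : ℕ → ℕ → ℝ} {α ε δ q : ℝ} (H : FourierBounds a σ α ε δ q) (I : ℝ)

include H

theorem y_nonneg : 0 ≤ 5 * ε := by linarith [H.ε_nonneg]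

theorem C_nonneg : 0 ≤ 216 * α := by linarith [H.α_nonneg]

theorem pow_le (k l : ℕ) : 5 ^ l * ε ^ (k + l) ≤ (5 * ε) ^ (k + l) := by
  have := H.ε_nonneg
  rw [mul_pow]
  gcongr
  · norm_num
  · omega

theorem abs_a_le (k l : ℕ) : |a k l| ≤ α * (5 * ε) ^ (k + l) := by
  have h1 := H.ε_nonneg
  have h2 := H.α_nonneg
  refine (H.abs_le k l).trans ?_
  gcongr
  linarith

theorem weighted_abs_A_le (k l : ℕ) :
    (1 + |k * I - l|) ^ 2 * |A a k l I| ≤ 216 * α * (5 * ε) ^ (k + l) := by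
  rw [A_eq, abs_mul, abs_of_pos (sechWeight_pos _), ← mul_assoc, mul_assoc 216]
  exact mul_le_mul (one_add_abs_sq_mul_sechWeight_le _) (H.abs_a_le k l) (abs_nonneg _)
    (by norm_num)

theorem abs_A_le (k l : ℕ) : |A a k l I| ≤ 216 * α * (5 * ε) ^ (k + l) := by
  refine le_trans ?_ (H.weighted_abs_A_le I k l)
  refine le_mul_of_one_le_left (abs_nonneg _) (one_le_pow₀ ?_)
  linarith [abs_nonneg (k * I - l)]

theorem abs_mul_A_le (k l : ℕ) : |(k * I - l) * A a k l I| ≤ 216 * α * (5 * ε) ^ (k + l) := by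
  refine le_trans ?_ (H.weighted_abs_A_le I k l)
  rw [abs_mul]
  gcongr
  nlinarith [abs_nonneg (k * I - l)]

/-- With ω = kI - l, k|I| ≤ |ω| + l trades the factor (1+|I|)k for (1+k+l)(1+|ω|), and `sechWeight`
absorbs two powers of 1+|ω|. -/
theorem one_add_abs_mul_le (k l : ℕ) : (1 + |I|) * |k * ((k * I - l) * A a k l I)|
    ≤ 216 * α * ((1 + k + l : ℝ) ^ 2 * (5 * ε) ^ (k + l)) := by
  have h := H.weighted_abs_A_le I k l
  set ω := (k : ℝ) * I - l with hω
  have hk : (0 : ℝ) ≤ k := by positivity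
  have hl : (0 : ℝ) ≤ l := by positivity
  have h1 : (1 + |I|) * k ≤ (1 + k + l) * (1 + |ω|) := by
    have : k * |I| ≤ |ω| + l := by
      calc k * |I| = |ω + l| := by rw [hω, sub_add_cancel, abs_mul, Nat.abs_cast]
        _ ≤ |ω| + |(l : ℝ)| := abs_add_le _ _
        _ = _ := by rw [Nat.abs_cast]
    nlinarith [abs_nonneg ω]
  rw [abs_mul, abs_mul, Nat.abs_cast]
  calc (1 + |I|) * (k * (|ω| * |A a k l I|)) = ((1 + |I|) * k) * (|ω| * |A a k l I|) := by ring
    _ ≤ ((1 + k + l) * (1 + |ω|)) * ((1 + |ω|) * |A a k l I|) := by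
        gcongr
        linarith
    _ = (1 + k + l) * ((1 + |ω|) ^ 2 * |A a k l I|) := by ring
    _ ≤ (1 + k + l) ^ 2 * (216 * α * (5 * ε) ^ (k + l)) := by
        gcongr
        nlinarith
    _ = _ := by ring

/-- The factor k removes the harmonics with k = 0, which do not decay in I; all others carry
`sechWeight I`, the weight in A_{1,0}. -/
theorem abs_natCast_mul_A_le (k l : ℕ) :
    |k * A a k l I| ≤ 216 * α * sechWeight I * ((1 + k + l : ℝ) * (5 * ε) ^ (k + l)) := by
  have hα := H.α_nonneg
  have hε := H.ε_nonneg
  have hw := sechWeight_pos I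
  rcases Nat.eq_zero_or_pos k with rfl | hk
  · simp only [Nat.cast_zero, zero_mul, abs_zero]
    positivity
  · rw [A_eq, abs_mul, abs_mul, abs_of_pos (sechWeight_pos _), Nat.abs_cast]
    calc k * (sechWeight (k * I - l) * |a k l|)
        ≤ (1 + k + l) * ((4 * 5 ^ l * sechWeight I) * (α * ε ^ (k + l))) := by
          have hl : (0 : ℝ) ≤ l := by positivity
          gcongr
          · exact mul_nonneg (sechWeight_pos _).le (abs_nonneg _)
          · linarith
          · exact sechWeight_mul_sub_le k l hk I
          · exact H.abs_le k l
      _ = 4 * α * sechWeight I * ((1 + k + l) * (5 ^ l * ε ^ (k + l))) := by ring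
      _ ≤ 216 * α * sechWeight I * ((1 + k + l) * (5 * ε) ^ (k + l)) := by
          gcongr
          · norm_num
          · exact H.pow_le k l

theorem summable_abs_a : Summable fun n : ℕ × ℕ => |a n.1 n.2| :=
  summable_abs_of_le 0 H.α_nonneg H.y_nonneg H.ε_le fun n => by
    simpa using H.abs_a_le n.1 n.2

omit H in
theorem two_le_sechWeight_neg_one : 2 ≤ sechWeight (-1) := by
  have hs : 0 < sinh (π / 2) := sinh_pos_iff.2 (by positivity)
  have h := sinh_half_pi_le
  have hp := pi_gt_three
  rw [sechWeight_neg_one, le_div_iff₀ hs]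
  norm_num at h
  linarith

/-- The 2 comes free from `sechWeight (-1)` ≥ 2 and is spent in `L_near`, which subtracts two values
of 𝓛. -/
theorem two_mul_tailBound_le : 2 * tailBound α ε ≤ δ * A a 0 1 I := by
  have h1 := H.tail_le₂
  have h2 := two_le_sechWeight_neg_one
  have h3 := mul_nonneg H.δ_nonneg H.pos₂.le
  rw [A_eq, show ((0 : ℕ) : ℝ) * I - (1 : ℕ) = -1 by simp]
  nlinarith

theorem tailBound_mul_le : tailBound α ε * sechWeight I ≤ δ * A a 1 0 I := by
  have h1 := mul_le_mul_of_nonneg_right H.tail_le₁ (sechWeight_pos I).le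
  rw [A_eq, show ((1 : ℕ) : ℝ) * I - (0 : ℕ) = I by simp]
  linarith

theorem tailBound_nonneg : 0 ≤ tailBound α ε := by
  have := H.α_nonneg
  have := tailConst_pos
  rw [tailBound]
  positivity

theorem A_zero_one_pos : 0 < A a 0 1 I := mul_pos (sechWeight_pos _) H.pos₂

theorem A_one_zero_pos : 0 < A a 1 0 I := mul_pos (sechWeight_pos _) H.pos₁

omit H in
theorem A_zero_one : A a 0 1 I = sechWeight (-1) * a 0 1 := by
  rw [A_eq]; simp

omit H in
theorem A_one_zero : A a 1 0 I = sechWeight I * a 1 0 := by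
  rw [A_eq]; simp

theorem mul_A_le_of_mul_sechWeight_le {t : ℝ}
    (ht : t * sechWeight I ≤ kappa * sechWeight (-1)) : t * A a 1 0 I ≤ q * A a 0 1 I := by
  have h1 := mul_le_mul_of_nonneg_right ht H.pos₁.le
  have h2 := mul_le_mul_of_nonneg_left H.kappa_mul_le (sechWeight_pos (-1)).le
  rw [A_zero_one, A_one_zero]
  linarith

theorem coeff_L_le (n : ℕ × ℕ) : |A a n.1 n.2 I|
    ≤ 216 * α * ((1 + n.1 + n.2 : ℝ) ^ 0 * (5 * ε) ^ (n.1 + n.2)) := by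
  simpa using H.abs_A_le I n.1 n.2

theorem coeff_L₁_le (n : ℕ × ℕ) : |n.1 * A a n.1 n.2 I|
    ≤ 216 * α * sechWeight I * ((1 + n.1 + n.2 : ℝ) ^ 1 * (5 * ε) ^ (n.1 + n.2)) := by
  simpa using H.abs_natCast_mul_A_le I n.1 n.2

theorem coeff_L₂_le (n : ℕ × ℕ) : |-n.2 * A a n.1 n.2 I|
    ≤ 216 * α * ((1 + n.1 + n.2 : ℝ) ^ 1 * (5 * ε) ^ (n.1 + n.2)) := by
  have h := H.abs_A_le I n.1 n.2
  have h1 : (0 : ℝ) ≤ n.1 := by positivity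
  rw [abs_mul, abs_neg, Nat.abs_cast]
  calc (n.2 : ℝ) * |A a n.1 n.2 I| ≤ (1 + n.1 + n.2) * (216 * α * (5 * ε) ^ (n.1 + n.2)) := by
        gcongr
        linarith
    _ = _ := by ring

theorem coeff_L₁₁_le (n : ℕ × ℕ) : |n.1 * (n.1 * A a n.1 n.2 I)|
    ≤ 216 * α * sechWeight I * ((1 + n.1 + n.2 : ℝ) ^ 2 * (5 * ε) ^ (n.1 + n.2)) := by
  have h := H.abs_natCast_mul_A_le I n.1 n.2
  have h1 : (0 : ℝ) ≤ n.2 := by positivity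
  rw [abs_mul, Nat.abs_cast]
  calc (n.1 : ℝ) * |n.1 * A a n.1 n.2 I| ≤ (1 + n.1 + n.2)
      * (216 * α * sechWeight I * ((1 + n.1 + n.2 : ℝ) * (5 * ε) ^ (n.1 + n.2))) := by
        gcongr
        linarith
    _ = _ := by ring

theorem coeff_L₁₂_le (n : ℕ × ℕ) : |-n.2 * (n.1 * A a n.1 n.2 I)|
    ≤ 216 * α * sechWeight I * ((1 + n.1 + n.2 : ℝ) ^ 2 * (5 * ε) ^ (n.1 + n.2)) := by
  have h := H.abs_natCast_mul_A_le I n.1 n.2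
  have h1 : (0 : ℝ) ≤ n.1 := by positivity
  rw [abs_mul, abs_neg, Nat.abs_cast]
  calc (n.2 : ℝ) * |n.1 * A a n.1 n.2 I| ≤ (1 + n.1 + n.2)
      * (216 * α * sechWeight I * ((1 + n.1 + n.2 : ℝ) * (5 * ε) ^ (n.1 + n.2))) := by
        gcongr
        linarith
    _ = _ := by ring

theorem coeff_G_le (n : ℕ × ℕ) : |(n.1 * I - n.2) * A a n.1 n.2 I|
    ≤ 216 * α * ((1 + n.1 + n.2 : ℝ) ^ 0 * (5 * ε) ^ (n.1 + n.2)) := by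
  simpa using H.abs_mul_A_le I n.1 n.2

theorem coeff_G₁_le (n : ℕ × ℕ) : |n.1 * ((n.1 * I - n.2) * A a n.1 n.2 I)|
    ≤ 216 * α / (1 + |I|) * ((1 + n.1 + n.2 : ℝ) ^ 2 * (5 * ε) ^ (n.1 + n.2)) := by
  rw [div_mul_eq_mul_div, le_div_iff₀ (by positivity), mul_comm]
  exact H.one_add_abs_mul_le I n.1 n.2

theorem coeff_G₂_le (n : ℕ × ℕ) : |-n.2 * ((n.1 * I - n.2) * A a n.1 n.2 I)|
    ≤ 216 * α * ((1 + n.1 + n.2 : ℝ) ^ 1 * (5 * ε) ^ (n.1 + n.2)) := by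
  have h := H.abs_mul_A_le I n.1 n.2
  have h1 : (0 : ℝ) ≤ n.1 := by positivity
  rw [abs_mul, abs_neg, Nat.abs_cast]
  calc (n.2 : ℝ) * |(n.1 * I - n.2) * A a n.1 n.2 I|
      ≤ (1 + n.1 + n.2) * (216 * α * (5 * ε) ^ (n.1 + n.2)) := by
        gcongr
        linarith
    _ = _ := by ring

theorem C₁_nonneg : 0 ≤ 216 * α * sechWeight I := mul_nonneg H.C_nonneg (sechWeight_pos I).le

theorem tail₁_le : 216 * α * sechWeight I * tailConst * (5 * ε) ^ 2 ≤ δ * A a 1 0 I := by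
  refine le_trans (le_of_eq ?_) (H.tailBound_mul_le I)
  rw [tailBound]
  ring

theorem tail₂_le : 216 * α * tailConst * (5 * ε) ^ 2 ≤ δ * A a 0 1 I := by
  have h := H.two_mul_tailBound_le I
  have h0 := H.tailBound_nonneg
  rw [← tailBound]
  linarith

theorem abs_L_sub_le (φ s : ℝ) :
    |trigSeries (fun n => A a n.1 n.2 I) (fun n => σ n.1 n.2) (φ, s)
      - (A a 0 0 I * cos (σ 0 0) + A a 1 0 I * cos φ + A a 0 1 I * cos s)| ≤ tailBound α ε := by
  have h := abs_trigSeries_sub_le (τ := fun n => σ n.1 n.2) (by norm_num) H.C_nonneg H.y_nonneg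
    H.ε_le (H.coeff_L_le I) (φ, s)
  simp only [H.σ₁, H.σ₂, sub_zero, add_zero] at h
  exact h

theorem abs_G_add_le (φ s : ℝ) :
    |trigSeries (fun n => (n.1 * I - n.2) * A a n.1 n.2 I) (phase₁ σ) (φ, s)
      + (I * A a 1 0 I * sin φ + A a 0 1 I * sin s)| ≤ tailBound α ε := by
  have h := abs_trigSeries_sub_le (τ := phase₁ σ) (by norm_num) H.C_nonneg H.y_nonneg H.ε_le
    (H.coeff_G_le I) (φ, s)
  refine le_of_eq_of_le (congrArg _ ?_) h
  simp [phase₁, H.σ₁, H.σ₂, cos_add_pi_div_two, ← sub_eq_add_neg, cos_sub_pi_div_two]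
  ring

theorem abs_G₁_add_le (φ s : ℝ) :
    (1 + |I|) * |trigSeries (fun n => n.1 * ((n.1 * I - n.2) * A a n.1 n.2 I)) (phase₂ σ) (φ, s)
      + I * A a 1 0 I * cos φ| ≤ tailBound α ε := by
  have h := abs_trigSeries_sub_le (τ := phase₂ σ) (by norm_num)
    (div_nonneg H.C_nonneg (by positivity : 0 ≤ 1 + |I|)) H.y_nonneg H.ε_le
    (H.coeff_G₁_le I) (φ, s)
  rw [← le_div_iff₀' (by positivity)]
  refine (le_of_eq_of_le (congrArg _ ?_) h).trans_eq (by rw [tailBound]; ring)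
  simp [phase₂, phase₁, H.σ₁, H.σ₂, sub_eq_add_neg]

theorem abs_G₂_add_le (φ s : ℝ) :
    |trigSeries (fun n => -n.2 * ((n.1 * I - n.2) * A a n.1 n.2 I)) (phase₂ σ) (φ, s)
      + A a 0 1 I * cos s| ≤ tailBound α ε := by
  have h := abs_trigSeries_sub_le (τ := phase₂ σ) (by norm_num) H.C_nonneg H.y_nonneg H.ε_le
    (H.coeff_G₂_le I) (φ, s)
  refine le_of_eq_of_le (congrArg _ ?_) h
  have e : cos (s + (-(π / 2) + -(π / 2))) = -cos s := by
    rw [← neg_add, add_halves, ← sub_eq_add_neg, cos_sub_pi]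
  simp [phase₂, phase₁, H.σ₁, H.σ₂, sub_eq_add_neg, e]

theorem abs_L₁_add_le (φ s : ℝ) :
    |trigSeries (fun n => n.1 * A a n.1 n.2 I) (phase₁ σ) (φ, s) + A a 1 0 I * sin φ|
      ≤ δ * A a 1 0 I := by
  have h := abs_trigSeries_sub_le (τ := phase₁ σ) (by norm_num) (H.C₁_nonneg I) H.y_nonneg H.ε_le
    (H.coeff_L₁_le I) (φ, s)
  refine le_of_eq_of_le (congrArg _ ?_) (h.trans (H.tail₁_le I))
  simp [phase₁, H.σ₁, H.σ₂, cos_add_pi_div_two]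

theorem abs_L₁₁_add_le (φ s : ℝ) :
    |trigSeries (fun n => n.1 * (n.1 * A a n.1 n.2 I)) (phase₂ σ) (φ, s) + A a 1 0 I * cos φ|
      ≤ δ * A a 1 0 I := by
  have h := abs_trigSeries_sub_le (τ := phase₂ σ) (by norm_num) (H.C₁_nonneg I) H.y_nonneg H.ε_le
    (H.coeff_L₁₁_le I) (φ, s)
  refine le_of_eq_of_le (congrArg _ ?_) (h.trans (H.tail₁_le I))
  simp [phase₂, phase₁, H.σ₁, H.σ₂, sub_eq_add_neg]

theorem abs_L₁₂_le (φ s : ℝ) :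
    |trigSeries (fun n => -n.2 * (n.1 * A a n.1 n.2 I)) (phase₂ σ) (φ, s)| ≤ δ * A a 1 0 I := by
  have h := abs_trigSeries_sub_le (τ := phase₂ σ) (by norm_num) (H.C₁_nonneg I) H.y_nonneg H.ε_le
    (H.coeff_L₁₂_le I) (φ, s)
  refine le_of_eq_of_le (congrArg _ ?_) (h.trans (H.tail₁_le I))
  simp

theorem G_eq_series (x : ℝ × ℝ) :
    trigSeries (fun n => (n.1 * I - n.2) * A a n.1 n.2 I) (phase₁ σ) x
      = I * trigSeries (fun n => n.1 * A a n.1 n.2 I) (phase₁ σ) x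
        + trigSeries (fun n => -n.2 * A a n.1 n.2 I) (phase₁ σ) x := by
  have h1 := summable_trigSeries (σ := phase₁ σ)
    (summable_abs_of_le 1 (H.C₁_nonneg I) H.y_nonneg H.ε_le (H.coeff_L₁_le I)) x
  have h2 := summable_trigSeries (σ := phase₁ σ)
    (summable_abs_of_le 1 H.C_nonneg H.y_nonneg H.ε_le (H.coeff_L₂_le I)) x
  rw [trigSeries, trigSeries, trigSeries, ← tsum_mul_left, ← (h1.mul_left I).tsum_add h2]
  exact tsum_congr fun n => by ring

end FourierBounds

/-! ### Transfer from the abstract model to the Melnikov potential. -/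

/-- The Fourier series of the Melnikov potential satisfies the conditions `NearCosine`. -/
def FourierBounds.nearCosine {a σ : ℕ → ℕ → ℝ} {α ε δ q : ℝ}
    (H : FourierBounds a σ α ε δ q) (I : ℝ) : NearCosine where
  L := trigSeries (fun n => APrioriUnstable.A a n.1 n.2 I) (fun n => σ n.1 n.2)
  L₁ := trigSeries (fun n => n.1 * APrioriUnstable.A a n.1 n.2 I) (phase₁ σ)
  L₂ := trigSeries (fun n => -n.2 * APrioriUnstable.A a n.1 n.2 I) (phase₁ σ)
  L₁₁ := trigSeries (fun n => n.1 * (n.1 * APrioriUnstable.A a n.1 n.2 I)) (phase₂ σ)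
  L₁₂ := trigSeries (fun n => -n.2 * (n.1 * APrioriUnstable.A a n.1 n.2 I)) (phase₂ σ)
  G := trigSeries (fun n => (n.1 * I - n.2) * APrioriUnstable.A a n.1 n.2 I) (phase₁ σ)
  G₁ := trigSeries (fun n => n.1 * ((n.1 * I - n.2) * APrioriUnstable.A a n.1 n.2 I)) (phase₂ σ)
  G₂ := trigSeries (fun n => -n.2 * ((n.1 * I - n.2) * APrioriUnstable.A a n.1 n.2 I)) (phase₂ σ)
  I := I
  A := APrioriUnstable.A a 1 0 I
  B := APrioriUnstable.A a 0 1 I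
  q := q
  δ := δ
  A_pos := H.A_one_zero_pos I
  B_pos := H.A_zero_one_pos I
  q_nonneg := H.q_nonneg
  q_lt_one := H.q_lt_one
  δ_nonneg := H.δ_nonneg
  δ_le := H.δ_le
  abs_mul_A_le := H.mul_A_le_of_mul_sechWeight_le I (abs_mul_sechWeight_le I)
  sq_mul_A_le := H.mul_A_le_of_mul_sechWeight_le I (sq_mul_sechWeight_le I)
  hasFDerivAt_L := hasFDerivAt_trigSeries
    (summable_mul_abs_of_le 0 H.C_nonneg H.y_nonneg H.ε_le (H.coeff_L_le I))
  hasFDerivAt_L₁ := hasFDerivAt_trigSeries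
    (summable_mul_abs_of_le 1 (H.C₁_nonneg I) H.y_nonneg H.ε_le (H.coeff_L₁_le I))
  hasFDerivAt_G := hasFDerivAt_trigSeries
    (summable_mul_abs_of_le 0 H.C_nonneg H.y_nonneg H.ε_le (H.coeff_G_le I))
  G_eq := H.G_eq_series I
  continuous_L₁₁ := continuous_trigSeries
    (summable_abs_of_le 2 (H.C₁_nonneg I) H.y_nonneg H.ε_le (H.coeff_L₁₁_le I))
  continuous_L₁₂ := continuous_trigSeries
    (summable_abs_of_le 2 (H.C₁_nonneg I) H.y_nonneg H.ε_le (H.coeff_L₁₂_le I))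
  continuous_G₁ := continuous_trigSeries
    (summable_abs_of_le 2 (div_nonneg H.C_nonneg (by positivity)) H.y_nonneg H.ε_le
      (H.coeff_G₁_le I))
  continuous_G₂ := continuous_trigSeries
    (summable_abs_of_le 1 H.C_nonneg H.y_nonneg H.ε_le (H.coeff_G₂_le I))
  L_add_fst := trigSeries_add_fst
  L_add_snd := trigSeries_add_snd
  L₁_add_fst := trigSeries_add_fst
  G_add_fst := trigSeries_add_fst
  G_add_snd := trigSeries_add_snd
  G_near φ s := (H.abs_G_add_le I φ s).trans (H.tail₂_le I)
  G₁_near φ s := (H.abs_G₁_add_le I φ s).trans (H.tail₂_le I)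
  G₂_near φ s := (H.abs_G₂_add_le I φ s).trans (H.tail₂_le I)
  L_near φ s := by
    have h1 := H.abs_L_sub_le I φ s
    have h2 := H.abs_L_sub_le I φ 0
    refine le_of_eq_of_le (congrArg _ ?_)
      (((abs_sub _ _).trans (add_le_add h1 h2)).trans ((two_mul _).symm.trans_le
        (H.two_mul_tailBound_le I)))
    rw [cos_zero]
    ring
  L₁_near := H.abs_L₁_add_le I
  L₁₁_near := H.abs_L₁₁_add_le I
  L₁₂_near := H.abs_L₁₂_le I

namespace FourierBounds

variable {a σ : ℕ → ℕ → ℝ} {α ε δ q e : ℝ} (H : FourierBounds a σ α ε δ q)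
  (he : e = 1 ∨ e = -1) (I : ℝ)

include H he

theorem melnikov_eq (φ s : ℝ) : melnikov a σ e I φ s = (H.nearCosine I).L (φ, s) :=
  melnikov_eq_trigSeries he H.summable_abs_a I φ s

theorem crest_eq : crest a σ e I = {x | (H.nearCosine I).G x = 0} := by
  ext ⟨φ, s⟩
  simp only [crest, Set.mem_ofPred_eq, H.melnikov_eq he]
  have h := (H.nearCosine I).hasFDerivAt_L (φ, s)
  have h1 := (h.comp_hasDerivAt φ ((hasDerivAt_id φ).prodMk (hasDerivAt_const φ s))).deriv
  have h2 := (h.comp_hasDerivAt s ((hasDerivAt_const s φ).prodMk (hasDerivAt_id s))).deriv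
  simp only [Function.comp_def, id_eq] at h1 h2
  rw [h1, h2, (H.nearCosine I).G_eq]
  simp [nearCosine]

theorem crestM_eq : crestM a σ e I = (H.nearCosine I).maxCrest := by
  simp only [crestM, NearCosine.maxCrest, H.crest_eq he, H.melnikov_eq he]

theorem mem_crestM_iff (φ s : ℝ) :
    (φ, s) ∈ crestM a σ e I ↔ ∃ n : ℤ, s = (H.nearCosine I).ξ φ + 2 * π * n := by
  rw [H.crestM_eq he, NearCosine.mem_maxCrest_iff]

/-- As |ξ| < π/2, only the translate n = 0 lies in (-π, π], which pins down the choice made by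
`Classical.epsilon`. -/
theorem xiM_eq (φ : ℝ) : xiM a σ e I φ = (H.nearCosine I).ξ φ := by
  have hp := pi_pos
  have hm := (H.nearCosine I).ξ_mem φ
  have hex : ∃ s, s ∈ Set.Ioc (-π) π ∧ (φ, s) ∈ crestM a σ e I :=
    ⟨(H.nearCosine I).ξ φ, ⟨by linarith [hm.1], by linarith [hm.2]⟩,
      (H.mem_crestM_iff he I φ _).2 ⟨0, by simp⟩⟩
  obtain ⟨h1, h2⟩ := Classical.epsilon_spec hex
  obtain ⟨n, hn⟩ := (H.mem_crestM_iff he I φ _).1 h2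
  change xiM a σ e I φ ∈ _ at h1
  change xiM a σ e I φ = _ at hn
  rw [hn] at h1 ⊢
  have hn0 : n = 0 := by
    by_contra hne
    rcases lt_or_gt_of_ne hne with h4 | h4
    · have h5 : (n : ℝ) ≤ -1 := by exact_mod_cast (by omega : n ≤ -1)
      have h6 : 2 * π * n ≤ 2 * π * -1 := by gcongr
      linarith [h1.1, hm.2]
    · have h5 : (1 : ℝ) ≤ n := by exact_mod_cast (by omega : 1 ≤ n)
      have h6 : 2 * π * 1 ≤ 2 * π * n := by gcongr
      linarith [h1.2, hm.1]
  simp [hn0]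

theorem isTauStar_iff {φ s τ : ℝ} (hs : |s| ≤ π / 2) :
    IsTauStar a σ e I φ s τ ↔ τ = (H.nearCosine I).τ₀ φ s := by
  rw [← (H.nearCosine I).isLeast_iff hs, IsTauStar, H.crestM_eq he, NearCosine.IsLeast]
  rfl

theorem tauStar_eq {φ s : ℝ} (hs : |s| ≤ π / 2) :
    tauStar a σ e I φ s = (H.nearCosine I).τ₀ φ s :=
  (H.isTauStar_iff he I hs).1 (Classical.epsilon_spec ⟨_, (H.isTauStar_iff he I hs).2 rfl⟩)

theorem melnikov_tauStar {φ s : ℝ} (hs : |s| ≤ π / 2) :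
    melnikov a σ e I (φ - I * tauStar a σ e I φ s) (s - tauStar a σ e I φ s)
      = (H.nearCosine I).reduced (φ - I * s) := by
  have h1 := (H.nearCosine I).sub_mul_τ₀ φ s
  have h2 := (H.nearCosine I).sub_τ₀ φ s
  rw [show (H.nearCosine I).I = I from rfl] at h1 h2
  rw [H.tauStar_eq he I hs, H.melnikov_eq he, h1, h2, NearCosine.reduced]

theorem reducedPoincare_eq : reducedPoincare a σ e I = (H.nearCosine I).reduced := by
  funext θ
  rw [reducedPoincare, H.melnikov_tauStar he I (by simp; positivity)]
  simp

theorem abs_xiM_sub_le (φ : ℝ) :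
    A a 0 1 I * |xiM a σ e I φ - -arcsin (crestSlope a I * sin φ)|
      ≤ 2 / (1 - q) * tailBound α ε := by
  rw [H.xiM_eq he]
  exact (H.nearCosine I).mul_abs_sub_arcsin_le φ (H.abs_G_add_le I φ)

theorem abs_reducedPoincare_sub_le (θ : ℝ) :
    |reducedPoincare a σ e I θ - (A a 0 0 I * cos (σ 0 0)
      + A a 1 0 I * cos (θ - I * tauStar a σ e I θ 0)
      + A a 0 1 I * cos (xiM a σ e I (θ - I * tauStar a σ e I θ 0)))| ≤ tailBound α ε := by
  have h1 : θ - I * tauStar a σ e I θ 0 = (H.nearCosine I).Ψ θ := by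
    rw [H.tauStar_eq he I (by simp; positivity)]
    have := (H.nearCosine I).sub_mul_τ₀ θ 0
    rw [mul_zero, sub_zero] at this
    exact this
  rw [h1, H.xiM_eq he, H.reducedPoincare_eq he]
  exact H.abs_L_sub_le I _ _

end FourierBounds

/-! ### Choice of the thresholds and conclusion. -/

/-- Smallness of a positive power of `ρ + r`. -/
theorem exists_mul_rpow_lt {γ D b : ℝ} (hγ : 0 < γ) (hD : 0 < D) (hb : 0 < b) :
    ∃ t : ℝ, 0 < t ∧ ∀ ρ r : ℝ, 0 < ρ → ρ ≤ t → 0 < r → r ≤ t → D * (ρ + r) ^ γ < b := by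
  refine ⟨(b / (2 * D)) ^ γ⁻¹ / 2, by positivity, fun ρ r hρ hρt hr hrt => ?_⟩
  have h1 : (ρ + r) ^ γ ≤ b / (2 * D) := by
    calc (ρ + r) ^ γ ≤ ((b / (2 * D)) ^ γ⁻¹) ^ γ :=
          rpow_le_rpow (by positivity) (by linarith) hγ.le
      _ = b / (2 * D) := by rw [← rpow_mul (by positivity), inv_mul_cancel₀ hγ.ne', rpow_one]
  calc D * (ρ + r) ^ γ ≤ D * (b / (2 * D)) := by gcongr
    _ = b / 2 := by field_simp
    _ < b := by linarith

theorem half_add_rpow_le {ρ r β x : ℝ} (hρ : 0 < ρ) (hr : 0 < r) (hβ : 0 ≤ β)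
    (h1 : ρ ^ β ≤ x) (h2 : r ^ β ≤ x) : ((ρ + r) / 2) ^ β ≤ x := by
  rcases le_total ρ r with h | h
  · exact (rpow_le_rpow (by positivity) (by linarith) hβ).trans h2
  · exact (rpow_le_rpow (by positivity) (by linarith) hβ).trans h1

/-- The lower bounds of the first coefficients control the harmonics of order at least two. -/
theorem tailBound_le_of_lower_bounds {α α' β ρ r c x : ℝ} (hα' : 0 < α')
    (hβ1 : 1 ≤ β) (hρ : 0 < ρ) (hr : 0 < r) (hα : 0 < α) (hc : 0 < c)
    (h1 : c * (α' * ρ ^ β) ≤ x) (h2 : c * (α' * r ^ β) ≤ x) :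
    tailBound α (ρ + r)
      ≤ 216 * α * tailConst * 25 * 2 ^ β / (c * α') * (ρ + r) ^ (2 - β) * x := by
  have hT := tailConst_pos
  have hε : 0 < ρ + r := by linarith
  have h3 : ((ρ + r) / 2) ^ β ≤ x / (c * α') :=
    half_add_rpow_le hρ hr (by linarith)
      (by rw [le_div_iff₀ (by positivity)]; linarith)
      (by rw [le_div_iff₀ (by positivity)]; linarith)
  -- Of the exponent 2, β is spent on the leading coefficient x, bounded below through the larger of
  -- ρ and r, which is at least their mean; 2 - β > 0 is what remains for smallness in the
  -- application.
  have h4 : (ρ + r) ^ 2 = (ρ + r) ^ (2 - β) * 2 ^ β * ((ρ + r) / 2) ^ β := by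
    rw [mul_assoc, ← mul_rpow (by norm_num) (by positivity), mul_div_cancel₀ _ two_ne_zero,
      ← rpow_add hε, sub_add_cancel]
    norm_cast
  rw [tailBound, mul_pow, h4]
  calc 216 * α * tailConst * (5 ^ 2 * ((ρ + r) ^ (2 - β) * 2 ^ β * ((ρ + r) / 2) ^ β))
      ≤ 216 * α * tailConst * (5 ^ 2 * ((ρ + r) ^ (2 - β) * 2 ^ β * (x / (c * α')))) := by gcongr
    _ = _ := by ring

end APrioriUnstable

end

open APrioriUnstable in
theorem proposition1
    (lam α α' β : ℝ) (hlam : 0 < lam) (hkappa : lam < 1 / kappa)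
    (hα' : 0 < α') (hα : α' < α) (hβ1 : 1 ≤ β) (hβ2 : β < 2) :
    ∃ ρs rs K : ℝ, 0 < ρs ∧ 0 < rs ∧ 0 < K ∧ ∀ Iplus η : ℝ, 0 < Iplus → 0 < η →
      ∃ ρη rη : ℝ, 0 < ρη ∧ 0 < rη ∧
      ∀ ρ r : ℝ, 0 < ρ → ρ < 1 → ρ ≤ ρs → 0 < r → r < 1 → r ≤ rs →
      ∀ (a σ : ℕ → ℕ → ℝ) (e : ℝ), (e = 1 ∨ e = -1) →
      (∀ k l : ℕ, α' * ρ ^ (β * (k : ℝ)) * r ^ (β * (l : ℝ)) ≤ |a k l| ∧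
        |a k l| ≤ α * ρ ^ k * r ^ l) →
      0 < a 1 0 → 0 < a 0 1 → σ 1 0 = 0 → σ 0 1 = 0 → |a 1 0 / a 0 1| = lam →
      ∀ I ∈ Set.Icc (-(1 / 2 : ℝ)) Iplus,
        -- the crest `C_M(I)` is the curve `s = ξ_M(I,φ)` on the torus
        (∀ φ s : ℝ, (φ, s) ∈ crestM a σ e I ↔ ∃ n : ℤ, s = xiM a σ e I φ + 2 * Real.pi * n) ∧
        (∀ φ : ℝ, A a 0 1 I * |xiM a σ e I φ - -Real.arcsin (crestSlope a I * Real.sin φ)|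
          ≤ K * (ρ + r) ^ 2) ∧
        -- `τ*` is well defined, and `𝓛*` is a function of `θ = φ - I s`
        (∀ φ s : ℝ, |s| ≤ Real.pi / 2 → (∃! τ : ℝ, IsTauStar a σ e I φ s τ) ∧
          reducedPoincare a σ e I (φ - I * s) =
            melnikov a σ e I (φ - I * tauStar a σ e I φ s) (s - tauStar a σ e I φ s)) ∧
        -- `𝓛*(I,·)` is cosine-like
        ContDiff ℝ 2 (reducedPoincare a σ e I) ∧
        Function.Periodic (reducedPoincare a σ e I) (2 * Real.pi) ∧
        (∃ θM θm : ℝ, θM < θm ∧ θm < θM + 2 * Real.pi ∧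
          (ρ ≤ ρη → r ≤ rη → |θM| < η ∧ |θm - Real.pi| < η) ∧
          deriv (reducedPoincare a σ e I) θM = 0 ∧
          deriv (deriv (reducedPoincare a σ e I)) θM < 0 ∧
          deriv (reducedPoincare a σ e I) θm = 0 ∧
          0 < deriv (deriv (reducedPoincare a σ e I)) θm ∧
          (∀ θ ∈ Set.Ioo θM θm, deriv (reducedPoincare a σ e I) θ < 0) ∧
          (∀ θ ∈ Set.Ioo θm (θM + 2 * Real.pi), 0 < deriv (reducedPoincare a σ e I) θ) ∧
          StrictAntiOn (reducedPoincare a σ e I) (Set.Icc θM θm) ∧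
          StrictMonoOn (reducedPoincare a σ e I) (Set.Icc θm (θM + 2 * Real.pi))) ∧
        -- the first order expression of `𝓛*`
        (∀ θ : ℝ, |reducedPoincare a σ e I θ -
            (A a 0 0 I * Real.cos (σ 0 0)
              + A a 1 0 I * Real.cos (θ - I * tauStar a σ e I θ 0)
              + A a 0 1 I * Real.cos (xiM a σ e I (θ - I * tauStar a σ e I θ 0)))|
          ≤ K * (ρ + r) ^ 2) := by
  have hκ : 0 < kappa := by linarith [kappa_bounds.1]
  have hα0 : 0 < α := hα'.trans hα
  have hT := tailConst_pos
  set q := kappa * lam with hq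
  have hq0 : 0 ≤ q := by positivity
  have hq1 : q < 1 := by rw [hq, mul_comm]; exact (lt_div_iff₀ hκ).1 hkappa
  have hp : 0 < 1 - q := by linarith
  -- The ratio λ converts a lower bound on either leading coefficient into one on the other, so with
  -- this c both exceed cα'ρ^β and cα'r^β.
  set c := min lam (min 1 (1 / lam)) with hc
  have hc0 : 0 < c := by positivity
  have hcl : c ≤ lam := min_le_left _ _
  have hc1 : c ≤ 1 := (min_le_right _ _).trans (min_le_left _ _)
  have hcl' : c ≤ 1 / lam := (min_le_right _ _).trans (min_le_right _ _)
  set D := 216 * α * tailConst * 25 * 2 ^ β / (c * α') with hD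
  have hD0 : 0 < D := by positivity
  obtain ⟨t, ht, hts⟩ := exists_mul_rpow_lt (γ := 2 - β) (D := D) (b := (1 - q) ^ 2 / 100)
    (by linarith) hD0 (by positivity)
  -- 1/20 ensures 5(ρ + r) ≤ 1/2. The thresholds and K are fixed before `Iplus`.
  refine ⟨min t (1 / 20), min t (1 / 20), 2 / (1 - q) * (216 * α * tailConst * 25), by positivity,
    by positivity, by positivity, fun Iplus η hI hη => ?_⟩
  -- The critical points are within 6δ(1+|I|) of 0 and π, and |I| ≤ 1 + `Iplus`.
  obtain ⟨u, hu, hus⟩ := exists_mul_rpow_lt (γ := 2 - β) (D := D) (b := η / (6 * (2 + Iplus)))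
    (by linarith) hD0 (by positivity)
  refine ⟨u, u, hu, hu, ?_⟩
  intro ρ r hρ hρ1 hρs hr hr1 hrs a σ e he hab h10 h01 hσ1 hσ2 hl I hIm
  have hrel : a 1 0 = lam * a 0 1 := by
    rw [abs_of_pos (div_pos h10 h01), div_eq_iff h01.ne'] at hl
    exact hl
  have hρε : ρ ≤ ρ + r := by linarith
  have hrε : r ≤ ρ + r := by linarith
  have hlow1 : α' * ρ ^ β ≤ a 1 0 := by
    have := (hab 1 0).1
    rwa [abs_of_pos h10, Nat.cast_one, Nat.cast_zero, mul_one, mul_zero, Real.rpow_zero,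
      mul_one] at this
  have hlow2 : α' * r ^ β ≤ a 0 1 := by
    have := (hab 0 1).1
    rwa [abs_of_pos h01, Nat.cast_one, Nat.cast_zero, mul_one, mul_zero, Real.rpow_zero,
      mul_one] at this
  have hpρ : 0 ≤ α' * ρ ^ β := by positivity
  have hpr : 0 ≤ α' * r ^ β := by positivity
  have H : FourierBounds a σ α (ρ + r) (D * (ρ + r) ^ (2 - β)) q :=
    { α_nonneg := hα0.le
      ε_nonneg := by positivity
      ε_le := by
        have h1 := hρs.trans (min_le_right _ _)
        have h2 := hrs.trans (min_le_right _ _)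
        linarith
      δ_nonneg := by positivity
      q_nonneg := hq0
      q_lt_one := hq1
      δ_le := (hts ρ r hρ (hρs.trans (min_le_left _ _)) hr (hrs.trans (min_le_left _ _))).le
      abs_le := fun k l => (hab k l).2.trans (by
        rw [mul_assoc, pow_add]
        gcongr)
      pos₁ := h10
      pos₂ := h01
      σ₁ := hσ1
      σ₂ := hσ2
      kappa_mul_le := by rw [hrel, hq, mul_assoc]
      tail_le₁ := tailBound_le_of_lower_bounds hα' hβ1 hρ hr hα0 hc0
        ((mul_le_of_le_one_left hpρ hc1).trans hlow1)
        (by rw [hrel]; exact mul_le_mul hcl hlow2 hpr hlam.le)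
      tail_le₂ := tailBound_le_of_lower_bounds hα' hβ1 hρ hr hα0 hc0
        (by
          have h : a 0 1 = 1 / lam * a 1 0 := by rw [hrel]; field_simp
          rw [h]
          exact mul_le_mul hcl' hlow1 hpρ (by positivity))
        ((mul_le_of_le_one_left hpr hc1).trans hlow2) }
  have hK : 2 / (1 - q) * (216 * α * tailConst * 25) * (ρ + r) ^ 2
      = 2 / (1 - q) * tailBound α (ρ + r) := by
    rw [tailBound]; ring
  have hK1 : tailBound α (ρ + r) ≤ 2 / (1 - q) * tailBound α (ρ + r) :=
    le_mul_of_one_le_left H.tailBound_nonneg (by rw [le_div_iff₀ hp]; linarith)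
  rw [hK]
  refine ⟨fun φ s => ?_, H.abs_xiM_sub_le he I, fun φ s hs => ⟨?_, ?_⟩, ?_, ?_, ?_, fun θ => ?_⟩
  · rw [H.xiM_eq he]
    exact H.mem_crestM_iff he I φ s
  · exact ⟨_, (H.isTauStar_iff he I hs).2 rfl, fun τ hτ => (H.isTauStar_iff he I hs).1 hτ⟩
  · rw [H.melnikov_tauStar he I hs, H.reducedPoincare_eq he]
  · rw [H.reducedPoincare_eq he]
    exact (H.nearCosine I).contDiff_reduced
  · rw [H.reducedPoincare_eq he]
    exact (H.nearCosine I).reduced_periodic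
  · rw [H.reducedPoincare_eq he]
    obtain ⟨θM, θm, h1, h2, hM, hm, h3⟩ := (H.nearCosine I).exists_critical_points
    refine ⟨θM, θm, h1, h2, fun hρu hru => ?_, h3⟩
    have hδ := hus ρ r hρ hρu hr hru
    have hI' : |I| ≤ 1 + Iplus := abs_le.2 ⟨by linarith [hIm.1], by linarith [hIm.2]⟩
    have hδ0 : 0 ≤ D * (ρ + r) ^ (2 - β) := by positivity
    have hlt : 6 * (D * (ρ + r) ^ (2 - β)) * (1 + |I|) < η := by
      rw [lt_div_iff₀ (by positivity)] at hδ
      nlinarith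
    exact ⟨hM.trans_lt hlt, hm.trans_lt hlt⟩
  · exact (H.abs_reducedPoincare_sub_le he I θ).trans hK1
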